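/- Let $G$ be a second countable locally compact (Hausdorff) group and let $\Gamma\subseteq G$ be a lattice, i.e. a closed discrete subgroup such that $G/\Gamma$ carries a nonzero bounded $G$-invariant measure. Let $\Omega\subseteq G$ be the range of a Borel cross section of the quotient map $G\to G/\Gamma$ (a fundamental domain, so that $G=\bigsqcup_{\gamma\in\Gamma}\Omega\gamma$), and let $\mu$ be the Haar measure on $G$ normalized so that $\mu(\Omega)=1$. Let $\mu_\Gamma$ be the counting measure on $\Gamma$, and for $\varphi:\Gamma\to\mathbb C$ put $$\hat\varphi=\chi_\Omega*\varphi\mu_\Gamma*\tilde\chi_\Omega,\qquad\text{i.e.}\qquad \hat\varphi(x)=\int_G\Big(\sum_{\gamma\in\Gamma}\chi_\Omega(y\gamma^{-1})\varphi(\gamma)\Big)\,\tilde\chi_\Omega(y^{-1}x)\,d\mu(y),$$ where $\tilde f(x)=\overline{f(x^{-1})}$. For a locally compact group $H$ with left regular representation $\lambda$ on $L^2(H)$ (for $H=\Gamma$: on $\ell^2(\Gamma)$), let $\mathfrak M(H)=\lambda(H)''$ be the group von Neumann algebra. The Fourier algebra $A(H)$ is the predual of $\mathfrak M(H)$, realized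 as functions on $H$ through $\omega\mapsto(x\mapsto\omega(\lambda(x)))$; that is, $A(H)$ consists of the functions $\psi(x)=\sum_n\langle\lambda(x)f_n,g_n\rangle$ with $f_n,g_n\in L^2(H)$ and $\sum_n\|f_n\|_2\|g_n\|_2<\infty$, and $\|\psi\|_{A(H)}$ is the infimum of $\sum_n\|f_n\|_2\|g_n\|_2$ over all such representations; the duality is $\langle T,\psi\rangle=\sum_n\langle Tf_n,g_n\rangle$ for $T\in\mathfrak M(H)$. The space $M_0A(H)$ of completely bounded multipliers consists of the continuous functions $\varphi$ on $H$ with $\varphi\psi\in A(H)$ for all $\psi\in A(H)$ for which the transposed operator $m_\varphi^*:\mathfrak M(H)\to\mathfrak M(H)$ of $m_\varphi:\psi\mapsto\varphi\psi$, given by $\langle m_\varphi^*T,\psi\rangle=\langle T,\varphi\psi\rangle$, is completely bounded, and $\|\varphi\|_{M_0A(H)}=\|m_\varphi^*\|_{cb}$. Then: 1. If $\varphi\in A(\Gamma)$, then $\hat\varphi\in A(G)$ and $\|\hat\varphi\|_{A(G)}\le\|\varphi\|_{A(\Gamma)}$. 2. If $\varphi\in M_0A(\Gamma)$, then $\hat\varphi\in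 M_0A(G)$ and $\|\hat\varphi\|_{M_0A(G)}\le\|\varphi\|_{M_0A(\Gamma)}$. -/

import Mathlib

open MeasureTheory
open scoped ENNReal

namespace FourierLattice

noncomputable section

section RegularRepresentation

variable {G : Type*} [Group G] [MeasurableSpace G] [MeasurableMul G]
  (μ : Measure G) [μ.IsMulLeftInvariant]

/-- The Hilbert space `L²(G, μ)` of complex square integrable functions. -/
abbrev L2 {X : Type*} [MeasurableSpace X] (μ : Measure X) : Type _ := Lp ℂ 2 μ

/-- The left regular representation `(λ(x) f)(y) = f(x⁻¹ y)` on `L²(G, μ)`. -/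
def leftReg (x : G) : L2 μ →L[ℂ] L2 μ :=
  (Lp.compMeasurePreservingₗᵢ ℂ (fun y : G => x⁻¹ * y)
    (measurePreserving_mul_left μ x⁻¹)).toContinuousLinearMap

/-- The group von Neumann algebra `M(G)` generated by the left regular representation: the
double commutant of `λ(G)` in `B(L²(G))`. (`StarSubalgebra.centralizer` is the commutant of
a set together with its adjoints.) -/
def groupVN : StarSubalgebra ℂ (L2 μ →L[ℂ] L2 μ) :=
  StarSubalgebra.centralizer ℂ
    (StarSubalgebra.centralizer ℂ (Set.range (leftReg μ)) : Set (L2 μ →L[ℂ] L2 μ))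

/-- `f, g` represent the function `φ` on `G` as a norm convergent sum of matrix coefficients of
the left regular representation: `φ(x) = ∑ₙ ⟨λ(x) fₙ, gₙ⟩` with `∑ₙ ‖fₙ‖ ‖gₙ‖ < ∞`.
In other words `T ↦ ∑ₙ ⟨T fₙ, gₙ⟩` is a normal functional on `M(G)` whose value at
`λ(x)` is `φ(x)`. (The `inner` of Mathlib is conjugate linear in its first argument.) -/
def Represents (φ : G → ℂ) (f g : ℕ → L2 μ) : Prop :=
  Summable (fun n => ‖f n‖ * ‖g n‖) ∧
    ∀ x, φ x = ∑' n, inner ℂ (g n) (leftReg μ x (f n))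

/-- The Fourier algebra `A(G)`, i.e. the predual of the group von Neumann algebra `M(G)`
realized as a space of functions on `G`: a normal functional `ω` on `M(G)` is identified with
`x ↦ ω(λ(x))`, and the normal functionals are those of the form `T ↦ ∑ₙ ⟨T fₙ, gₙ⟩` with
`∑ₙ ‖fₙ‖ ‖gₙ‖ < ∞`. -/
def fourierAlgebra : Set (G → ℂ) :=
  {φ | ∃ f g : ℕ → L2 μ, Represents μ φ f g}

/-- The norm of `A(G)`: the predual norm, which is the quotient norm of the projective tensor
norm, `‖φ‖ = inf ∑ₙ ‖fₙ‖ ‖gₙ‖` over all representations of `φ`. -/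
def fourierNorm (φ : G → ℂ) : ℝ :=
  sInf {c | ∃ f g : ℕ → L2 μ, Represents μ φ f g ∧ c = ∑' n, ‖f n‖ * ‖g n‖}

/-- `Φ : M(G) → M(G)` is the transposed `m_φ^*` of the multiplication operator
`m_φ : ψ ↦ φ ψ` on `A(G)`, i.e. `⟨Φ(T), ψ⟩ = ⟨T, φ ψ⟩` for all `T ∈ M(G)` and `ψ ∈ A(G)`, where
the duality of `M(G)` and `A(G)` is `⟨T, ψ⟩ = ∑ₙ ⟨T fₙ, gₙ⟩` for `ψ = ∑ₙ ⟨λ(·) fₙ, gₙ⟩`. -/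
def IsTransposedMul (φ : G → ℂ) (Φ : groupVN μ →ₗ[ℂ] groupVN μ) : Prop :=
  ∀ (T : groupVN μ) (ψ : G → ℂ) (f g f' g' : ℕ → L2 μ),
    Represents μ ψ f g → Represents μ (fun x => φ x * ψ x) f' g' →
      ∑' n, inner ℂ (g n) ((Φ T : L2 μ →L[ℂ] L2 μ) (f n)) =
        ∑' n, inner ℂ (g' n) ((T : L2 μ →L[ℂ] L2 μ) (f' n))

end RegularRepresentation

section CompletelyBounded

variable {H : Type*} [NormedAddCommGroup H] [InnerProductSpace ℂ H]

/-- An `n × n` matrix of operators on `H`, acting on the Hilbert space direct sum `Hⁿ` by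
`(T v)ᵢ = ∑ⱼ Tᵢⱼ vⱼ`. Its operator norm is the norm of `B(H) ⊗ Mₙ(ℂ)`. -/
def opMatrix {n : ℕ} (T : Fin n → Fin n → H →L[ℂ] H) :
    PiLp 2 (fun _ : Fin n => H) →L[ℂ] PiLp 2 (fun _ : Fin n => H) :=
  ((PiLp.continuousLinearEquiv 2 ℂ (fun _ : Fin n => H)).symm :
      (Fin n → H) →L[ℂ] PiLp 2 (fun _ : Fin n => H)) ∘L
    ContinuousLinearMap.pi (fun i => ∑ j, T i j ∘L PiLp.proj 2 (fun _ : Fin n => H) j)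

/-- The linear map `Φ` on the operator algebra `M ⊆ B(H)` is completely bounded with
`‖Φ‖_cb ≤ C`, i.e. `‖Φ ⊗ idₙ‖ ≤ C` on `M ⊗ Mₙ(ℂ)` for all `n`. -/
def CBBound [CompleteSpace H] {M : StarSubalgebra ℂ (H →L[ℂ] H)} (Φ : M →ₗ[ℂ] M) (C : ℝ) : Prop :=
  ∀ (n : ℕ) (T : Fin n → Fin n → M),
    ‖opMatrix (fun i j => (Φ (T i j) : H →L[ℂ] H))‖ ≤
      C * ‖opMatrix (fun i j => (T i j : H →L[ℂ] H))‖

end CompletelyBounded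

section Multipliers

variable {G : Type*} [Group G] [TopologicalSpace G] [MeasurableSpace G] [MeasurableMul G]
  (μ : Measure G) [μ.IsMulLeftInvariant]

/-- The multipliers `MA(G)` of the Fourier algebra. -/
def multipliers : Set (G → ℂ) :=
  {φ | Continuous φ ∧ ∀ ψ ∈ fourierAlgebra μ, (fun x => φ x * ψ x) ∈ fourierAlgebra μ}

/-- The completely bounded multipliers `M₀A(G)`: the multipliers `φ` for which the transposed
operator `m_φ^*` on `M(G)` is completely bounded. -/
def cbMultipliers : Set (G → ℂ) :=
  {φ | φ ∈ multipliers μ ∧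
    ∃ (Φ : groupVN μ →ₗ[ℂ] groupVN μ) (C : ℝ), IsTransposedMul μ φ Φ ∧ 0 ≤ C ∧ CBBound Φ C}

/-- The norm of `M₀A(G)`: the completely bounded norm of `m_φ^*`. -/
def cbMultiplierNorm (φ : G → ℂ) : ℝ :=
  sInf {C | 0 ≤ C ∧ ∃ Φ : groupVN μ →ₗ[ℂ] groupVN μ, IsTransposedMul μ φ Φ ∧ CBBound Φ C}

end Multipliers

section Lattices

variable {G : Type*} [Group G] [MeasurableSpace G]

/-- A lattice: a closed discrete subgroup `Γ` such that `G ⧸ Γ` carries a (nonzero) bounded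
`G`-invariant measure. -/
structure IsLattice [TopologicalSpace G] (Γ : Subgroup G) : Prop where
  isClosed : IsClosed (Γ : Set G)
  discrete : DiscreteTopology Γ
  exists_invariant : ∃ ν : Measure (G ⧸ Γ),
    IsFiniteMeasure ν ∧ ν ≠ 0 ∧ SMulInvariantMeasure G (G ⧸ Γ) ν

/-- `Ω` is a fundamental domain: the range of a Borel cross section of the quotient map
`G → G ⧸ Γ`. -/
def IsBorelFundamentalDomain (Γ : Subgroup G) (Ω : Set G) : Prop :=
  ∃ σ : G ⧸ Γ → G, Measurable σ ∧ (∀ q : G ⧸ Γ, (QuotientGroup.mk (σ q) : G ⧸ Γ) = q) ∧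
    Ω = Set.range σ

/-- The characteristic function of `Ω`. -/
def chi (Ω : Set G) : G → ℂ := Ω.indicator 1

/-- `f̃(x) = conj f(x⁻¹)`. -/
def tilde (f : G → ℂ) (x : G) : ℂ := starRingEnd ℂ (f x⁻¹)

/-- The convolution `f * φ μ_Γ` of a function with the measure `φ μ_Γ`, where `μ_Γ` is the
counting measure on `Γ`. -/
def convCount (Γ : Subgroup G) (f : G → ℂ) (φ : Γ → ℂ) (x : G) : ℂ :=
  ∑' γ : Γ, f (x * (γ : G)⁻¹) * φ γ

/-- The convolution `(f * g)(x) = ∫ f(y) g(y⁻¹ x) dμ(y)` of functions on `G`. -/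
def conv (μ : Measure G) (f g : G → ℂ) (x : G) : ℂ :=
  ∫ y, f y * g (y⁻¹ * x) ∂μ

/-- `φ̂ = χ_Ω * φ μ_Γ * χ̃_Ω`. -/
def hat (μ : Measure G) (Γ : Subgroup G) (Ω : Set G) (φ : Γ → ℂ) : G → ℂ :=
  conv μ (convCount Γ (chi Ω) φ) (tilde (chi Ω))

end Lattices

end

end FourierLattice

/-! Write σ for the cross section. The decomposition y = σ(q)γ identifies (G, μ) with (G ⧸ Γ, ν) ×
(Γ, counting), where ν is the invariant probability measure, so L²(G) = L²(G ⧸ Γ) ⊗ ℓ²(Γ). In these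
coordinates left translation is a skew product: at q, λ(x)(e ⊗ f) equals e(x⁻¹q) λ_Γ(c(x,q)) f, with
the cocycle c(x,q) = (`fib` (x⁻¹σ(q)))⁻¹ in Γ. Moreover φ̂(x) = ∫ φ(c(x,q)) dν(q) (`hat_eq`).

For the Fourier algebra this is enough: if φ = ∑ ⟨λ_Γ(·)fₙ, gₙ⟩, then φ̂ = ∑ ⟨λ(·)(1 ⊗ fₙ), 1 ⊗ gₙ⟩,
and ‖1 ⊗ f‖ = ‖f‖ because ν has mass one (`represents_hat`).

For multipliers, M(G) lies in B(L²(G ⧸ Γ)) ⊗ M(Γ) (`entry_mem`). The amplification id ⊗ m_φ^* has cb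
norm at most that of m_φ^* and sends λ(x) to λ(x) followed by multiplication by the weight q ↦
φ(c(x,q)) (`exists_amplified`). Conjugating by right translations, which commute with λ, and
averaging over Ω replaces the weight by its mean φ̂(x) without increasing the cb norm
(`integral_weight_rightTranslate`). The averaged map is therefore m_φ̂^*
(`exists_isTransposedMul_of_form`).

Operator-valued maps are handled as sesquilinear maps (v, u) ↦ Λ v u with values in functionals on
M(G). Two facts reduce statements about all of M(G) to the operators λ(x): normal functionals are
determined by their values on λ(G) (`tsum_inner_eq_of_leftReg`, from a double commutant argument),
and they form a norm closed subspace (`isClosed_normalFunctionals`), so that limits and averages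
stay normal. -/

namespace FourierLattice

noncomputable section

open Filter Topology

set_option linter.unusedSectionVars false

/-! ### Normal functionals on an operator algebra, and closedness of the predual -/

section NormalFunctionals

variable {H : Type*} [NormedAddCommGroup H] [InnerProductSpace ℂ H]

/-- The functional `T ↦ ⟨T f, g⟩` on `B(H)`. -/
def vectorForm (f g : H) : (H →L[ℂ] H) →L[ℂ] ℂ :=
  (innerSL ℂ g) ∘L (ContinuousLinearMap.apply ℂ H f)

@[simp]
theorem vectorForm_apply (f g : H) (T : H →L[ℂ] H) : vectorForm f g T = inner ℂ g (T f) := rfl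

theorem norm_inner_apply_le (T : H →L[ℂ] H) (f g : H) :
    ‖(inner ℂ g (T f) : ℂ)‖ ≤ ‖T‖ * (‖f‖ * ‖g‖) :=
  calc ‖(inner ℂ g (T f) : ℂ)‖ ≤ ‖g‖ * ‖T f‖ := norm_inner_le_norm _ _
    _ ≤ ‖g‖ * (‖T‖ * ‖f‖) := by gcongr; exact T.le_opNorm f
    _ = _ := by ring

theorem summable_inner_apply {ι : Type*} {f g : ι → H} (h : Summable fun i => ‖f i‖ * ‖g i‖)
    (T : H →L[ℂ] H) : Summable fun i => (inner ℂ (g i) (T (f i)) : ℂ) :=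
  Summable.of_norm_bounded (h.mul_left ‖T‖) fun i => norm_inner_apply_le T (f i) (g i)

/-- An absolutely convergent sum of vector functionals can be indexed by `ℕ`. -/
theorem exists_nat_indexed {ι : Type*} {f g : ι → H} (h : Summable fun i => ‖f i‖ * ‖g i‖) :
    ∃ f' g' : ℕ → H, Summable (fun n => ‖f' n‖ * ‖g' n‖) ∧
      (∑' n, ‖f' n‖ * ‖g' n‖) = ∑' i, ‖f i‖ * ‖g i‖ ∧
      ∀ T : H →L[ℂ] H, ∑' n, (inner ℂ (g' n) (T (f' n)) : ℂ) = ∑' i, inner ℂ (g i) (T (f i)) := by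
  -- The index type may be uncountable (`H × H` below), but summability makes the support countable;
  -- it is injected into ℕ and the families are extended by zero.
  set s := Function.support fun i => ‖f i‖ * ‖g i‖ with hs
  have hc : s.Countable := h.countable_support
  obtain ⟨j, hj⟩ := Set.countable_iff_exists_injective.1 hc
  have key : ∀ {E : Type _} [NormedAddCommGroup E] (b : H → H → E), b 0 0 = 0 →
      (fun n => b (Function.extend j (fun i : s => f i) 0 n)
        (Function.extend j (fun i : s => g i) 0 n)) =
        Function.extend j (fun i : s => b (f i) (g i)) 0 := by
    intro E _ b hb
    funext n
    by_cases hn : ∃ a, j a = n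
    · obtain ⟨a, rfl⟩ := hn
      simp [hj.extend_apply]
    · simp [Function.extend_apply' _ _ _ hn, hb]
  have key2 : ∀ {E : Type _} [NormedAddCommGroup E] (b : H → H → E), b 0 0 = 0 →
      (∀ u v, ‖u‖ * ‖v‖ = 0 → b u v = 0) →
      ∑' n, b (Function.extend j (fun i : s => f i) 0 n)
        (Function.extend j (fun i : s => g i) 0 n) = ∑' i, b (f i) (g i) := by
    intro E _ b hb hb'
    rw [key b hb, tsum_extend_zero hj]
    refine tsum_subtype_eq_of_support_subset (f := fun i => b (f i) (g i)) fun i hi => ?_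
    exact fun h0 => hi (hb' _ _ h0)
  refine ⟨Function.extend j (fun i : s => f i) 0, Function.extend j (fun i : s => g i) 0, ?_, ?_,
    fun T => ?_⟩
  · rw [key (fun u v => ‖u‖ * ‖v‖) (by simp)]
    exact (summable_extend_zero hj).2 (h.subtype s)
  · exact key2 (fun u v => ‖u‖ * ‖v‖) (by simp) (fun u v h => h)
  · refine key2 (fun u v => (inner ℂ v (T u) : ℂ)) (by simp) (fun u v h => ?_)
    rcases mul_eq_zero.1 h with h | h <;> simp [norm_eq_zero.1 h]

/-- The unit vector in the direction of `f`, and `0` if `f = 0`. -/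
def unitVec (f : H) : H := ((‖f‖⁻¹ : ℝ) : ℂ) • f

theorem norm_unitVec_le (f : H) : ‖unitVec f‖ ≤ 1 := by
  unfold unitVec
  rcases eq_or_ne f 0 with rfl | h
  · simp
  · rw [norm_smul]; simp [h]

theorem norm_smul_unitVec (f : H) : (‖f‖ : ℂ) • unitVec f = f := by
  unfold unitVec
  rcases eq_or_ne f 0 with rfl | h
  · simp
  · rw [smul_smul, ← Complex.ofReal_mul, mul_inv_cancel₀ (norm_ne_zero_iff.2 h)]; simp

variable [CompleteSpace H] (M : StarSubalgebra ℂ (H →L[ℂ] H))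

/-- The inclusion of an operator algebra in `B(H)`. -/
def incl : M →L[ℂ] (H →L[ℂ] H) := M.toSubmodule.subtypeL

@[simp]
theorem incl_apply (T : M) : incl M T = (T : H →L[ℂ] H) := rfl

theorem norm_vectorForm_comp_incl_le (f g : H) : ‖vectorForm f g ∘L incl M‖ ≤ ‖f‖ * ‖g‖ := by
  refine ContinuousLinearMap.opNorm_le_bound _ (by positivity) fun T => ?_
  have := norm_inner_apply_le (T : H →L[ℂ] H) f g
  rw [mul_comm]
  exact this

theorem vectorForm_unitVec_incl (f g : H) :
    ((‖f‖ * ‖g‖ : ℝ) : ℂ) • (vectorForm (unitVec f) (unitVec g) ∘L incl M) =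
      vectorForm f g ∘L incl M := by
  ext T
  conv_rhs => rw [← norm_smul_unitVec f, ← norm_smul_unitVec g]
  simp
  ring

/-- The map `ℓ¹(H × H) → M^*` which takes the basis vector at `(f, g)` to the functional
`T ↦ ⟨T f, g⟩` with `f` and `g` normalized. -/
def sumForms : lp (fun _ : H × H => ℂ) 1 →L[ℂ] (M →L[ℂ] ℂ) :=
  (lp.tsumCLM ℂ (H × H) (M →L[ℂ] ℂ)) ∘L
    (lp.mapCLM 1 (fun s : H × H => ContinuousLinearMap.toSpanSingleton ℂ
      (vectorForm (unitVec s.1) (unitVec s.2) ∘L incl M)) zero_le_one (fun s => by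
        rw [ContinuousLinearMap.norm_toSpanSingleton]
        exact (norm_vectorForm_comp_incl_le M _ _).trans
          (mul_le_one₀ (norm_unitVec_le _) (norm_nonneg _) (norm_unitVec_le _))))

theorem sumForms_apply (z : lp (fun _ : H × H => ℂ) 1) :
    sumForms M z = ∑' s, z s • (vectorForm (unitVec s.1) (unitVec s.2) ∘L incl M) := by
  simp [sumForms]

theorem summable_norm_lp_one {α : Type*} (z : lp (fun _ : α => ℂ) 1) : Summable fun s => ‖z s‖ := by
  have := (lp.memℓp z).summable (by simp)
  simpa using this

theorem sumForms_apply_apply (z : lp (fun _ : H × H => ℂ) 1) (T : M) :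
    sumForms M z T =
      ∑' s, inner ℂ (unitVec s.2) ((T : H →L[ℂ] H) (z s • unitVec s.1)) := by
  rw [sumForms_apply]
  have hsum : Summable fun s : H × H => z s • (vectorForm (unitVec s.1) (unitVec s.2) ∘L incl M) := by
    refine Summable.of_norm_bounded (summable_norm_lp_one z) fun s => ?_
    rw [norm_smul]
    refine mul_le_of_le_one_right (norm_nonneg _) ?_
    exact (norm_vectorForm_comp_incl_le M _ _).trans
          (mul_le_one₀ (norm_unitVec_le _) (norm_nonneg _) (norm_unitVec_le _))
  have := (ContinuousLinearMap.apply ℂ ℂ T).map_tsum hsum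
  simp only [ContinuousLinearMap.apply_apply] at this
  rw [this]
  simp

/-- The normal functionals on `M`: absolutely convergent sums of functionals `T ↦ ⟨T f, g⟩`. -/
def normalFunctionals : Submodule ℂ (M →L[ℂ] ℂ) := (sumForms M).range

theorem sumForms_single [DecidableEq (H × H)] (f g : H) (c : ℂ) :
    sumForms M (lp.single 1 (f, g) c) = c • (vectorForm (unitVec f) (unitVec g) ∘L incl M) := by
  rw [sumForms_apply, tsum_eq_single (f, g)]
  · simp
  · intro s hs
    rw [lp.single_apply_ne _ _ _ hs]
    exact zero_smul ℂ (vectorForm (unitVec s.1) (unitVec s.2) ∘L incl M)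

theorem vectorForm_mem_normalFunctionals (f g : H) :
    vectorForm f g ∘L incl M ∈ normalFunctionals M := by
  classical
  refine ⟨lp.single 1 (f, g) ((‖f‖ * ‖g‖ : ℝ) : ℂ), ?_⟩
  change sumForms M _ = _
  rw [sumForms_single, vectorForm_unitVec_incl]

theorem exists_of_mem_normalFunctionals {Λ : M →L[ℂ] ℂ} (h : Λ ∈ normalFunctionals M) :
    ∃ f g : ℕ → H, Summable (fun n => ‖f n‖ * ‖g n‖) ∧
      ∀ T : M, Λ T = ∑' n, inner ℂ (g n) ((T : H →L[ℂ] H) (f n)) := by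
  obtain ⟨z, hz⟩ := h
  change sumForms M z = Λ at hz
  have hs : Summable fun s : H × H => ‖z s • unitVec s.1‖ * ‖unitVec s.2‖ := by
    refine Summable.of_nonneg_of_le (fun _ => by positivity) (fun s => ?_) (summable_norm_lp_one z)
    rw [norm_smul, mul_assoc]
    exact mul_le_of_le_one_right (norm_nonneg _)
      (mul_le_one₀ (norm_unitVec_le _) (norm_nonneg _) (norm_unitVec_le _))
  obtain ⟨f, g, h1, -, h3⟩ := exists_nat_indexed hs
  refine ⟨f, g, h1, fun T => ?_⟩
  rw [← hz, sumForms_apply_apply, h3]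

/-- Bounded sesquilinear forms come from operators. -/
theorem exists_operator_of_form (B : H → H → ℂ) (C : ℝ) 
    (hadd : ∀ f f' g, B (f + f') g = B f g + B f' g) (hsmul : ∀ (c : ℂ) f g, B (c • f) g = c * B f g)
    (hadd' : ∀ f g g', B f (g + g') = B f g + B f g')
    (hsmul' : ∀ (c : ℂ) f g, B f (c • g) = starRingEnd ℂ c * B f g)
    (hB : ∀ f g, ‖B f g‖ ≤ C * ‖f‖ * ‖g‖) :
    ∃ T : H →L[ℂ] H, ∀ f g, inner ℂ g (T f) = B f g := by
  let b : H →L⋆[ℂ] H →L[ℂ] ℂ := LinearMap.mkContinuous₂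
    (LinearMap.mk₂'ₛₗ (starRingEnd ℂ) (RingHom.id ℂ) (fun g f => B f g)
      (fun g g' f => hadd' f g g') (fun c g f => hsmul' c f g)
      (fun g f f' => hadd f f' g) (fun c g f => hsmul c f g)) C
    (fun g f => by
      refine (hB f g).trans (le_of_eq ?_); ring)
  -- The Riesz operator of `b` acts in the first slot of the inner product; the adjoint moves it to
  -- the second.
  refine ⟨ContinuousLinearMap.adjoint (InnerProductSpace.continuousLinearMapOfBilin b), fun f g => ?_⟩
  rw [ContinuousLinearMap.adjoint_inner_right, InnerProductSpace.continuousLinearMapOfBilin_apply]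
  rfl

variable {M}

/-- A bounded functional on `ℓ¹(H × H)` that vanishes on the kernel of `sumForms` is evaluation at an
operator of `M`, if `M` is a commutant. -/
theorem exists_eval_of_functional {S : Set (H →L[ℂ] H)} (hM : M = StarSubalgebra.centralizer ℂ S)
    (L : lp (fun _ : H × H => ℂ) 1 →L[ℂ] ℂ) (hL : ∀ z, sumForms M z = 0 → L z = 0) :
    ∃ T : M, ‖T‖ ≤ ‖L‖ ∧ ∀ z, L z = sumForms M z T := by
  classical
  have hL2 : ∀ z z', sumForms M z = sumForms M z' → L z = L z' := fun z z' h => by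
    rw [← sub_eq_zero, ← map_sub]; exact hL _ (by rw [map_sub, h, sub_self])
  let e : H → H → lp (fun _ : H × H => ℂ) 1 := fun f g =>
    lp.single 1 (f, g) ((‖f‖ * ‖g‖ : ℝ) : ℂ)
  have he : ∀ f g, sumForms M (e f g) = vectorForm f g ∘L incl M := fun f g => by
    simp only [e]; rw [sumForms_single, vectorForm_unitVec_incl]
  have hnorm : ∀ f g, ‖L (e f g)‖ ≤ ‖L‖ * ‖f‖ * ‖g‖ := fun f g => by
    refine (L.le_opNorm _).trans (le_of_eq ?_)
    simp only [e]
    rw [lp.norm_single (by simp)]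
    simp [mul_assoc]
  obtain ⟨T, hT⟩ := exists_operator_of_form (fun f g => L (e f g)) ‖L‖
    (fun f f' g => by
      rw [← map_add]; refine hL2 _ _ ?_; rw [map_add, he, he, he]; ext; simp)
    (fun c f g => by
      rw [← smul_eq_mul, ← map_smul]; refine hL2 _ _ ?_; rw [map_smul, he, he]; ext
      simp)
    (fun f f' g => by
      rw [← map_add]; refine hL2 _ _ ?_; rw [map_add, he, he, he]; ext; simp)
    (fun c f g => by
      rw [← smul_eq_mul, ← map_smul]; refine hL2 _ _ ?_; rw [map_smul, he, he]; ext
      simp [mul_comm])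
    hnorm
  have hTn : ‖T‖ ≤ ‖L‖ := by
    refine T.opNorm_le_bound (norm_nonneg _) fun f => ?_
    rcases eq_or_ne (T f) 0 with h0 | h0
    · rw [h0, norm_zero]; positivity
    have h1 := hnorm f (T f)
    rw [← hT f (T f), inner_self_eq_norm_sq_to_K] at h1
    have h2 : ‖T f‖ * ‖T f‖ ≤ ‖L‖ * ‖f‖ * ‖T f‖ := by
      simpa [sq] using h1
    exact le_of_mul_le_mul_right h2 (norm_pos_iff.2 h0)
  -- If `R` commutes with `M`, the pairs (f, R^* g) and (R f, g) induce the same functional on `M`,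
  -- so `L` cannot distinguish them; this is commutation of `T` with `R`.
  have hcomm : ∀ R : H →L[ℂ] H, (∀ A : M, (A : H →L[ℂ] H) * R = R * (A : H →L[ℂ] H)) → R * T = T * R := by
    intro R hR
    ext f
    refine ext_inner_left ℂ fun g => ?_
    change inner ℂ g (R (T f)) = inner ℂ g (T (R f))
    rw [← ContinuousLinearMap.adjoint_inner_left, hT, hT]
    refine hL2 _ _ ?_
    rw [he, he]
    ext A
    have := congrArg (fun B : H →L[ℂ] H => B f) (hR A)
    simp only [mul_apply_eq_comp] at this
    simp [ContinuousLinearMap.adjoint_inner_left, this]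
  have hTM : T ∈ M := by
    rw [hM, StarSubalgebra.mem_centralizer_iff]
    have hM' : ∀ A : M, ∀ R ∈ S, R * (A : H →L[ℂ] H) = A * R ∧ star R * (A : H →L[ℂ] H) = A * star R :=
      fun A R hR => (StarSubalgebra.mem_centralizer_iff ℂ).1 (hM ▸ A.2) R hR
    intro R hR
    exact ⟨hcomm R fun A => (hM' A R hR).1.symm, hcomm _ fun A => (hM' A R hR).2.symm⟩
  refine ⟨⟨T, hTM⟩, hTn, fun z => ?_⟩
  have : L = (ContinuousLinearMap.apply ℂ ℂ (⟨T, hTM⟩ : M)) ∘L sumForms M := by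
    refine lp.ext_continuousLinearMap (by simp) fun s => ?_
    ext
    change L (lp.single 1 s 1) = sumForms M (lp.single 1 s 1) ⟨T, hTM⟩
    have h1 : sumForms M (lp.single 1 s (1 : ℂ)) = sumForms M (e (unitVec s.1) (unitVec s.2)) := by
      rw [he, show s = (s.1, s.2) from rfl, sumForms_single, one_smul]
    rw [hL2 _ _ h1, h1, he, ← hT]
    rfl
  rw [this]
  rfl

/-- The map induced by `sumForms` on ℓ¹(H × H) modulo its kernel is bounded below: by Hahn–Banach a
vector of the quotient is normed by a functional of norm at most one, which is evaluation at a `T`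
in the unit ball of `M`. A map bounded below on a complete space has closed range. -/
theorem isClosed_normalFunctionals {S : Set (H →L[ℂ] H)} (hM : M = StarSubalgebra.centralizer ℂ S) :
    IsClosed (normalFunctionals M : Set (M →L[ℂ] ℂ)) := by
  let K : Submodule ℂ (lp (fun _ : H × H => ℂ) 1) := (sumForms M).ker
  let q : (lp (fun _ : H × H => ℂ) 1 ⧸ K) →L[ℂ] (M →L[ℂ] ℂ) := K.liftQL (sumForms M) le_rfl
  have hq : ∀ z, q (K.mkQ z) = sumForms M z := fun z => rfl
  have hanti : AntilipschitzWith 1 q := by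
    refine AddMonoidHomClass.antilipschitz_of_bound q fun x => ?_
    obtain ⟨z, rfl⟩ := K.mkQ_surjective x
    obtain ⟨l, hl, hlx⟩ := exists_dual_vector'' ℂ (K.mkQ z)
    obtain ⟨T, hT, hT'⟩ := exists_eval_of_functional hM (l ∘L K.mkQL) (fun w hw => by
      change l (K.mkQ w) = 0
      rw [show K.mkQ w = 0 from (Submodule.Quotient.mk_eq_zero K).2 hw, map_zero])
    have hl1 : ‖l ∘L K.mkQL‖ ≤ 1 := by
      refine ContinuousLinearMap.opNorm_le_bound _ zero_le_one fun w => ?_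
      rw [one_mul]
      refine (l.le_opNorm _).trans ?_
      exact (mul_le_of_le_one_left (norm_nonneg _) hl).trans (Submodule.Quotient.norm_mk_le K w)
    have h2 : (‖K.mkQ z‖ : ℂ) = sumForms M z T := by
      rw [← hT' z]; exact hlx.symm
    have h3 : ‖K.mkQ z‖ = ‖sumForms M z T‖ := by rw [← h2]; simp
    rw [h3, hq]
    refine (ContinuousLinearMap.le_opNorm _ _).trans ?_
    simp only [NNReal.coe_one, one_mul]
    exact mul_le_of_le_one_right (norm_nonneg _) (hT.trans hl1)
  have : IsClosed (K : Set (lp (fun _ : H × H => ℂ) 1)) := (sumForms M).isClosed_ker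
  have hset : (normalFunctionals M : Set (M →L[ℂ] ℂ)) = Set.range q := by
    ext Λ
    constructor
    · rintro ⟨z, rfl⟩; exact ⟨K.mkQ z, rfl⟩
    · rintro ⟨x, rfl⟩
      obtain ⟨z, rfl⟩ := K.mkQ_surjective x
      exact ⟨z, rfl⟩
  rw [hset]
  exact hanti.isClosed_range q.uniformContinuous

theorem mem_normalFunctionals_of_sum {S : Set (H →L[ℂ] H)}
    (hM : M = StarSubalgebra.centralizer ℂ S) {ι : Type*} {f g : ι → H}
    (h : Summable fun i => ‖f i‖ * ‖g i‖) (Λ : M →L[ℂ] ℂ)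
    (hΛ : ∀ T : M, Λ T = ∑' i, inner ℂ (g i) ((T : H →L[ℂ] H) (f i))) :
    Λ ∈ normalFunctionals M := by
  have hs : Summable fun i => vectorForm (f i) (g i) ∘L incl M :=
    Summable.of_norm_bounded h fun i => norm_vectorForm_comp_incl_le M _ _
  have : Λ = ∑' i, vectorForm (f i) (g i) ∘L incl M := by
    ext T
    have := (ContinuousLinearMap.apply ℂ ℂ T).map_tsum hs
    simp only [ContinuousLinearMap.apply_apply] at this
    rw [this, hΛ]
    rfl
  rw [this]
  exact (isClosed_normalFunctionals hM).mem_of_tendsto hs.hasSum (Filter.Eventually.of_forall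
    fun s => Submodule.sum_mem _ fun i _ => vectorForm_mem_normalFunctionals M _ _)

end NormalFunctionals

/-! ### Von Neumann's density argument in the amplification ℓ²(ℕ, H) -/

section DoubleCommutant

variable {H : Type*} [NormedAddCommGroup H] [InnerProductSpace ℂ H]

/-- The diagonal amplification of an operator to `ℓ²(ℕ, H)`. -/
def amp (A : H →L[ℂ] H) : lp (fun _ : ℕ => H) 2 →L[ℂ] lp (fun _ : ℕ => H) 2 :=
  lp.mapCLM 2 (fun _ => A) (norm_nonneg A) (fun _ => le_rfl)

@[simp]
theorem amp_apply (A : H →L[ℂ] H) (ξ : lp (fun _ : ℕ => H) 2) (n : ℕ) : amp A ξ n = A (ξ n) := by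
  simp [amp]

theorem amp_single (A : H →L[ℂ] H) (n : ℕ) (x : H) :
    amp A (lp.single 2 n x) = lp.single 2 n (A x) := by
  ext m
  rw [amp_apply]
  rcases eq_or_ne m n with rfl | h
  · simp
  · simp [h]

variable [CompleteSpace H]

theorem inner_amp_left (A : H →L[ℂ] H) (ξ η : lp (fun _ : ℕ => H) 2) :
    (inner ℂ (amp (star A) η) ξ : ℂ) = inner ℂ η (amp A ξ) := by
  rw [lp.inner_eq_tsum, lp.inner_eq_tsum]
  simp [ContinuousLinearMap.star_eq_adjoint, ContinuousLinearMap.adjoint_inner_left]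

/-- Operators of the double commutant of a self-adjoint monoid of operators act on cyclic subspaces of
the amplification. -/
theorem inner_amp_eq_zero {S : Set (H →L[ℂ] H)} (h1 : 1 ∈ S) (hmul : ∀ a ∈ S, ∀ b ∈ S, a * b ∈ S)
    (hstar : ∀ a ∈ S, star a ∈ S) {T : H →L[ℂ] H}
    (hT : T ∈ StarSubalgebra.centralizer ℂ (StarSubalgebra.centralizer ℂ S : Set (H →L[ℂ] H)))
    (ξ η : lp (fun _ : ℕ => H) 2) (h : ∀ a ∈ S, (inner ℂ η (amp a ξ) : ℂ) = 0) :
    (inner ℂ η (amp T ξ) : ℂ) = 0 := by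
  let K : Submodule ℂ (lp (fun _ : ℕ => H) 2) :=
    (Submodule.span ℂ ((fun a => amp a ξ) '' S)).topologicalClosure
  have hgen : ∀ a ∈ S, amp a ξ ∈ K := fun a ha =>
    Submodule.le_topologicalClosure _ (Submodule.subset_span ⟨a, ha, rfl⟩)
  have hKc : IsClosed (K : Set (lp (fun _ : ℕ => H) 2)) := Submodule.isClosed_topologicalClosure _
  have hind : ∀ N : Submodule ℂ (lp (fun _ : ℕ => H) 2), IsClosed (N : Set (lp (fun _ : ℕ => H) 2)) →
      (∀ a ∈ S, amp a ξ ∈ N) → K ≤ N := fun N hN hN' =>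
    Submodule.topologicalClosure_minimal _ (Submodule.span_le.2 (by rintro _ ⟨a, ha, rfl⟩; exact hN' a ha)) hN
  have hinv : ∀ a ∈ S, ∀ x ∈ K, amp a x ∈ K := fun a ha x hx => by
    refine hind (K.comap (amp a).toLinearMap) (hKc.preimage (amp a).continuous) (fun b hb => ?_) hx
    have : amp a (amp b ξ) = amp (a * b) ξ := by ext n; simp
    change amp a (amp b ξ) ∈ K
    rw [this]
    exact hgen _ (hmul a ha b hb)
  have hinv' : ∀ a ∈ S, ∀ x ∈ Kᗮ, amp a x ∈ Kᗮ := fun a ha x hx => by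
    rw [Submodule.mem_orthogonal] at hx ⊢
    intro u hu
    rw [← inner_amp_left]
    exact hx _ (hinv _ (hstar a ha) u hu)
  have : CompleteSpace K := hKc.completeSpace_coe
  let P := K.starProjection
  have hPK : ∀ x ∈ K, P x = x := fun x hx => Submodule.starProjection_eq_self_iff.2 hx
  have hPK' : ∀ x ∈ Kᗮ, P x = 0 := fun x hx => by
    exact (Submodule.starProjection_apply_eq_zero_iff K).2 hx
  have hPmem : ∀ x, P x ∈ K := fun x => Submodule.starProjection_apply_mem K x
  have hPsub : ∀ x, x - P x ∈ Kᗮ := fun x => Submodule.sub_starProjection_mem_orthogonal x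
  have hPcomm : ∀ a ∈ S, ∀ x, P (amp a x) = amp a (P x) := fun a ha x => by
    have : amp a x = amp a (P x) + amp a (x - P x) := by rw [← map_add]; congr 1; abel
    rw [this, map_add, hPK _ (hinv a ha _ (hPmem x)), hPK' _ (hinv' a ha _ (hPsub x)), add_zero]
  -- The matrix entries of the projection onto the cyclic subspace lie in the commutant of `S`, so
  -- `T` commutes with each of them, and hence `amp T` commutes with the projection.
  let R : ℕ → ℕ → H →L[ℂ] H := fun m n =>
    (lp.evalCLM ℂ (fun _ : ℕ => H) 2 m) ∘L P ∘L (lp.singleContinuousLinearMap ℂ (fun _ : ℕ => H) 2 n)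
  have hRapp : ∀ m n x, R m n x = P (lp.single 2 n x) m := fun m n x => rfl
  have hRS : ∀ m n, R m n ∈ StarSubalgebra.centralizer ℂ S := fun m n => by
    have hc : ∀ a ∈ S, a * R m n = R m n * a := fun a ha => by
      ext x
      rw [mul_apply_eq_comp, mul_apply_eq_comp, hRapp, hRapp, ← amp_single, hPcomm a ha, amp_apply]
    rw [StarSubalgebra.mem_centralizer_iff]
    exact fun a ha => ⟨hc a ha, hc _ (hstar a ha)⟩
  have hPT : P ∘L amp T = amp T ∘L P := by
    refine lp.ext_continuousLinearMap (by simp) fun n => ?_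
    ext x m
    change P (amp T (lp.single 2 n x)) m = amp T (P (lp.single 2 n x)) m
    rw [amp_single, amp_apply, ← hRapp, ← hRapp]
    have := ((StarSubalgebra.mem_centralizer_iff ℂ).1 hT (R m n) (hRS m n)).1
    exact congrArg (fun B : H →L[ℂ] H => B x) this
  have hξ : ξ ∈ K := by
    have := hgen 1 h1
    have h2 : amp 1 ξ = ξ := by ext; simp
    rwa [h2] at this
  have hTξ : amp T ξ ∈ K := by
    have := congrArg (fun B : lp (fun _ : ℕ => H) 2 →L[ℂ] lp (fun _ : ℕ => H) 2 => B ξ) hPT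
    change P (amp T ξ) = amp T (P ξ) at this
    rw [hPK ξ hξ] at this
    rw [← this]; exact hPmem _
  have hη : K ≤ LinearMap.ker (innerSL ℂ η : _ →ₗ[ℂ] ℂ) :=
    hind _ (innerSL ℂ η).isClosed_ker fun a ha => h a ha
  exact hη hTξ

/-- A normal functional is a single vector functional on the amplification. To get square summable
vectors, each pair is rescaled so that both members have norm √(‖f n‖ ‖g n‖). -/
theorem tsum_inner_eq_zero_of_mem_doubleCommutant {S : Set (H →L[ℂ] H)} (h1 : 1 ∈ S)
    (hmul : ∀ a ∈ S, ∀ b ∈ S, a * b ∈ S) (hstar : ∀ a ∈ S, star a ∈ S) {T : H →L[ℂ] H}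
    (hT : T ∈ StarSubalgebra.centralizer ℂ (StarSubalgebra.centralizer ℂ S : Set (H →L[ℂ] H)))
    {f g : ℕ → H} (hfg : Summable fun n => ‖f n‖ * ‖g n‖)
    (h : ∀ a ∈ S, ∑' n, (inner ℂ (g n) (a (f n)) : ℂ) = 0) :
    ∑' n, (inner ℂ (g n) (T (f n)) : ℂ) = 0 := by
  let r : ℕ → ℂ := fun n => (√(‖f n‖ * ‖g n‖) : ℝ)
  have hmem : ∀ u : ℕ → H, Memℓp (fun n => r n • unitVec (u n)) 2 := fun u => by
    refine memℓp_gen ?_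
    refine Summable.of_nonneg_of_le (fun _ => by positivity) (fun n => ?_) hfg
    have h2 : ‖r n • unitVec (u n)‖ ≤ √(‖f n‖ * ‖g n‖) := by
      rw [norm_smul]
      refine (mul_le_of_le_one_right (norm_nonneg _) (norm_unitVec_le _)).trans ?_
      simp only [r, Complex.norm_real, Real.norm_eq_abs, abs_of_nonneg (Real.sqrt_nonneg _), le_refl]
    calc ‖r n • unitVec (u n)‖ ^ (2 : ℝ≥0∞).toReal = ‖r n • unitVec (u n)‖ ^ 2 := by simp
      _ ≤ √(‖f n‖ * ‖g n‖) ^ 2 := by gcongr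
      _ = _ := Real.sq_sqrt (by positivity)
  let ξ : lp (fun _ : ℕ => H) 2 := ⟨_, hmem f⟩
  let η : lp (fun _ : ℕ => H) 2 := ⟨_, hmem g⟩
  have key : ∀ A : H →L[ℂ] H, (inner ℂ η (amp A ξ) : ℂ) = ∑' n, inner ℂ (g n) (A (f n)) := by
    intro A
    rw [lp.inner_eq_tsum]
    congr 1
    funext n
    rw [amp_apply]
    change inner ℂ (r n • unitVec (g n)) (A (r n • unitVec (f n))) = _
    conv_rhs => rw [← norm_smul_unitVec (f n), ← norm_smul_unitVec (g n)]
    have hr : r n * r n = ‖f n‖ * ‖g n‖ := by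
      simp only [r]
      rw [← Complex.ofReal_mul, Real.mul_self_sqrt (by positivity)]; simp
    simp only [map_smul, inner_smul_left, inner_smul_right, Complex.conj_ofReal, r] at hr ⊢
    linear_combination (inner ℂ (unitVec (g n)) (A (unitVec (f n)))) * hr
  rw [← key]
  exact inner_amp_eq_zero h1 hmul hstar hT ξ η fun a ha => by rw [key]; exact h a ha

end DoubleCommutant

/-! ### The left regular representation; normal functionals are determined on λ(G) -/

section RegularRepresentation

variable {G : Type*} [Group G] [MeasurableSpace G] [MeasurableMul G]
  (μ : Measure G) [μ.IsMulLeftInvariant]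

theorem coeFn_leftReg (x : G) (f : L2 μ) : leftReg μ x f =ᵐ[μ] fun y => f (x⁻¹ * y) :=
  Lp.coeFn_compMeasurePreserving f (measurePreserving_mul_left μ x⁻¹)

theorem norm_leftReg_apply (x : G) (f : L2 μ) : ‖leftReg μ x f‖ = ‖f‖ :=
  (Lp.compMeasurePreservingₗᵢ ℂ (fun y : G => x⁻¹ * y)
    (measurePreserving_mul_left μ x⁻¹)).norm_map f

theorem leftReg_one : leftReg μ (1 : G) = 1 := by
  ext1 f
  refine Lp.ext ?_
  filter_upwards [coeFn_leftReg μ 1 f] with y hy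
  simp [hy]

theorem leftReg_mul (x y : G) : leftReg μ (x * y) = leftReg μ x * leftReg μ y := by
  ext1 f
  refine Lp.ext ?_
  have h := (measurePreserving_mul_left μ x⁻¹).quasiMeasurePreserving.ae (coeFn_leftReg μ y f)
  filter_upwards [coeFn_leftReg μ (x * y) f, coeFn_leftReg μ x (leftReg μ y f), h] with z h1 h2 h3
  rw [h1, mul_apply_eq_comp, h2, h3, mul_inv_rev, mul_assoc]

theorem star_leftReg (x : G) : star (leftReg μ x) = leftReg μ x⁻¹ := by
  rw [ContinuousLinearMap.star_eq_adjoint, eq_comm, ContinuousLinearMap.eq_adjoint_iff]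
  intro f g
  let U := Lp.compMeasurePreservingₗᵢ ℂ (E := ℂ) (p := 2) (fun y : G => x⁻¹ * y)
    (measurePreserving_mul_left μ x⁻¹)
  have : inner ℂ (U (leftReg μ x⁻¹ f)) (U g) = (inner ℂ (leftReg μ x⁻¹ f) g : ℂ) := U.inner_map_map _ _
  rw [← this]
  change inner ℂ ((leftReg μ x * leftReg μ x⁻¹) f) (leftReg μ x g) = _
  rw [← leftReg_mul, mul_inv_cancel, leftReg_one]
  rfl

theorem leftReg_mem_groupVN (x : G) : leftReg μ x ∈ groupVN μ := by
  refine (StarSubalgebra.mem_centralizer_iff ℂ).2 fun R hR => ?_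
  have := (StarSubalgebra.mem_centralizer_iff ℂ).1 hR _ ⟨x, rfl⟩
  refine ⟨this.1.symm, ?_⟩
  have h2 := congrArg star this.2
  rw [star_mul, star_mul, star_star] at h2
  exact h2

/-- The left regular representation as elements of the group von Neumann algebra. -/
def leftRegVN (x : G) : groupVN μ := ⟨leftReg μ x, leftReg_mem_groupVN μ x⟩

@[simp]
theorem coe_leftRegVN (x : G) : (leftRegVN μ x : L2 μ →L[ℂ] L2 μ) = leftReg μ x := rfl

/-- A normal functional on `M(G)` is determined by its values on `λ(G)`. -/
theorem tsum_inner_eq_of_leftReg {ι κ : Type*} {f g : ι → L2 μ} {f' g' : κ → L2 μ}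
    (hfg : Summable fun n => ‖f n‖ * ‖g n‖) (hfg' : Summable fun n => ‖f' n‖ * ‖g' n‖)
    (h : ∀ x, ∑' n, (inner ℂ (g n) (leftReg μ x (f n)) : ℂ) =
      ∑' n, inner ℂ (g' n) (leftReg μ x (f' n))) (T : groupVN μ) :
    ∑' n, (inner ℂ (g n) ((T : L2 μ →L[ℂ] L2 μ) (f n)) : ℂ) =
      ∑' n, inner ℂ (g' n) ((T : L2 μ →L[ℂ] L2 μ) (f' n)) := by
  let F : ι ⊕ κ → L2 μ := Sum.elim f f'
  -- The sign makes the family on `ι ⊕ κ` represent the difference of the two functionals, which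
  -- vanishes on λ(G).
  let F' : ι ⊕ κ → L2 μ := Sum.elim g (fun n => -g' n)
  have hF : Summable fun s => ‖F s‖ * ‖F' s‖ := by
    refine Summable.sum _ ?_ ?_
    · simpa [Function.comp_def, F, F'] using hfg
    · simpa [Function.comp_def, F, F'] using hfg'
  obtain ⟨u, v, huv, -, h3⟩ := exists_nat_indexed hF
  have key : ∀ A : L2 μ →L[ℂ] L2 μ, ∑' n, (inner ℂ (v n) (A (u n)) : ℂ) =
      ∑' n, (inner ℂ (g n) (A (f n)) : ℂ) - ∑' n, inner ℂ (g' n) (A (f' n)) := by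
    intro A
    rw [h3, Summable.tsum_sum]
    · simp [F, F', tsum_neg, sub_eq_add_neg]
    · simpa [Function.comp_def, F, F'] using summable_inner_apply hfg A
    · simpa [Function.comp_def, F, F'] using (summable_inner_apply hfg' A).neg
  rw [← sub_eq_zero, ← key]
  refine tsum_inner_eq_zero_of_mem_doubleCommutant (S := Set.range (leftReg μ)) ⟨1, leftReg_one μ⟩
    ?_ ?_ T.2 huv ?_
  · rintro _ ⟨x, rfl⟩ _ ⟨y, rfl⟩
    exact ⟨x * y, leftReg_mul μ x y⟩
  · rintro _ ⟨x, rfl⟩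
    exact ⟨x⁻¹, (star_leftReg μ x).symm⟩
  · rintro _ ⟨x, rfl⟩
    rw [key, sub_eq_zero]
    exact h x

theorem eq_of_mem_normalFunctionals {Λ Λ' : groupVN μ →L[ℂ] ℂ} (h : Λ ∈ normalFunctionals (groupVN μ))
    (h' : Λ' ∈ normalFunctionals (groupVN μ)) (heq : ∀ x, Λ (leftRegVN μ x) = Λ' (leftRegVN μ x)) :
    Λ = Λ' := by
  obtain ⟨f, g, h1, h2⟩ := exists_of_mem_normalFunctionals _ h
  obtain ⟨f', g', h1', h2'⟩ := exists_of_mem_normalFunctionals _ h'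
  ext T
  rw [h2, h2']
  exact tsum_inner_eq_of_leftReg μ h1 h1' (fun x => by
    have := heq x
    rwa [h2, h2'] at this) T

end RegularRepresentation

/-! ### Operator matrices bounded as sesquilinear forms -/

section FormBound

variable {H : Type*} [NormedAddCommGroup H] [InnerProductSpace ℂ H]

/-- The operator matrix `T` is bounded by `c` as a sesquilinear form on the Hilbert space
direct sum. -/
def FormBound {κ : Type*} [Fintype κ] (T : κ → κ → H →L[ℂ] H) (c : ℝ) : Prop :=
  ∀ u v : κ → H, ‖∑ k, ∑ l, (inner ℂ (v k) (T k l (u l)) : ℂ)‖ ≤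
    c * (√(∑ k, ‖u k‖ ^ 2) * √(∑ k, ‖v k‖ ^ 2))

theorem inner_opMatrix {n : ℕ} (T : Fin n → Fin n → H →L[ℂ] H) (u v : PiLp 2 fun _ : Fin n => H) :
    (inner ℂ v (opMatrix T u) : ℂ) = ∑ k, ∑ l, inner ℂ (v k) (T k l (u l)) := by
  rw [PiLp.inner_apply]
  refine Finset.sum_congr rfl fun k _ => ?_
  rw [← inner_sum]
  congr 1
  simp [opMatrix]

theorem formBound_opMatrix {n : ℕ} (T : Fin n → Fin n → H →L[ℂ] H) : FormBound T ‖opMatrix T‖ := by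
  intro u v
  have h := norm_inner_apply_le (opMatrix T) (WithLp.toLp 2 u) (WithLp.toLp 2 v)
  rw [inner_opMatrix] at h
  simpa [PiLp.norm_eq_of_L2] using h

theorem FormBound.norm_opMatrix_le {n : ℕ} {T : Fin n → Fin n → H →L[ℂ] H} {c : ℝ} (hc : 0 ≤ c)
    (h : FormBound T c) : ‖opMatrix T‖ ≤ c := by
  refine ContinuousLinearMap.opNorm_le_bound _ hc fun u => ?_
  rcases eq_or_ne (opMatrix T u) 0 with h0 | h0
  · rw [h0, norm_zero]; positivity
  have h1 := h (fun k => u k) (fun k => opMatrix T u k)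
  rw [← inner_opMatrix, inner_self_eq_norm_sq_to_K, ← PiLp.norm_eq_of_L2, ← PiLp.norm_eq_of_L2] at h1
  have h2 : ‖opMatrix T u‖ * ‖opMatrix T u‖ ≤ c * ‖u‖ * ‖opMatrix T u‖ := by
    simpa [sq, mul_assoc] using h1
  exact le_of_mul_le_mul_right h2 (norm_pos_iff.2 h0)

theorem FormBound.reindex {κ κ' : Type*} [Fintype κ] [Fintype κ'] (e : κ' ≃ κ)
    {T : κ → κ → H →L[ℂ] H} {c : ℝ} (h : FormBound T c) :
    FormBound (fun k l => T (e k) (e l)) c := by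
  intro u v
  have h1 := h (fun k => u (e.symm k)) (fun k => v (e.symm k))
  rw [← e.sum_comp, ← e.sum_comp, ← e.sum_comp] at h1
  simp_rw [← e.sum_comp (fun l => (inner ℂ _ (T _ l _) : ℂ))] at h1
  simpa using h1

variable [CompleteSpace H]

/-- Frees complete boundedness from the index type `Fin n`; matrices indexed by a product `κ × F`
are needed for the amplification. -/
theorem CBBound.formBound {M : StarSubalgebra ℂ (H →L[ℂ] H)} {Φ : M →ₗ[ℂ] M} {C : ℝ} (hC : 0 ≤ C)
    (hΦ : CBBound Φ C) {κ : Type*} [Fintype κ] (T : κ → κ → M) {c : ℝ} (hc : 0 ≤ c)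
    (h : FormBound (fun k l => (T k l : H →L[ℂ] H)) c) :
    FormBound (fun k l => (Φ (T k l) : H →L[ℂ] H)) (C * c) := by
  let e := Fintype.equivFin κ
  have h1 := (h.reindex e.symm).norm_opMatrix_le hc
  have h2 := hΦ _ (fun k l => T (e.symm k) (e.symm l))
  have h3 := formBound_opMatrix (fun k l => (Φ (T (e.symm k) (e.symm l)) : H →L[ℂ] H))
  have h4 := h3.reindex e
  simp only [Equiv.symm_apply_apply] at h4
  intro u v
  refine (h4 u v).trans ?_
  gcongr
  exact h2.trans (by gcongr)

theorem CBBound.norm_apply_le {M : StarSubalgebra ℂ (H →L[ℂ] H)} {Φ : M →ₗ[ℂ] M} {C : ℝ} (hC : 0 ≤ C)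
    (hΦ : CBBound Φ C) (T : M) : ‖(Φ T : H →L[ℂ] H)‖ ≤ C * ‖(T : H →L[ℂ] H)‖ := by
  have h1 : FormBound (fun _ _ : Unit => (T : H →L[ℂ] H)) ‖(T : H →L[ℂ] H)‖ := fun u v => by
    simpa using norm_inner_apply_le (T : H →L[ℂ] H) (u ()) (v ())
  have h2 := hΦ.formBound hC (fun _ _ : Unit => T) (norm_nonneg _) h1
  refine ContinuousLinearMap.opNorm_le_bound _ (by positivity) fun u => ?_
  rcases eq_or_ne ((Φ T : H →L[ℂ] H) u) 0 with h0 | h0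
  · rw [h0, norm_zero]; positivity
  have h3 := h2 (fun _ => u) (fun _ => (Φ T : H →L[ℂ] H) u)
  simp only [Finset.univ_unique, Finset.sum_const, Finset.card_singleton, one_smul] at h3
  rw [inner_self_eq_norm_sq_to_K] at h3
  have h4 : ‖(Φ T : H →L[ℂ] H) u‖ * ‖(Φ T : H →L[ℂ] H) u‖ ≤
      C * ‖(T : H →L[ℂ] H)‖ * ‖u‖ * ‖(Φ T : H →L[ℂ] H) u‖ := by
    simpa [sq, mul_assoc] using h3
  exact le_of_mul_le_mul_right h4 (norm_pos_iff.2 h0)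

end FormBound

/-! ### The coordinates G ≃ G ⧸ Γ × Γ and the cocycle of a Borel section -/

section BorelSection

variable {G : Type*} [Group G] [MeasurableSpace G] {Γ : Subgroup G}

/-- A Borel cross section of the quotient map `G → G ⧸ Γ`. -/
structure BorelSection (Γ : Subgroup G) where
  toFun : G ⧸ Γ → G
  measurable : Measurable toFun
  mk_eq : ∀ q, (QuotientGroup.mk (toFun q) : G ⧸ Γ) = q

namespace BorelSection

variable (s : BorelSection Γ)

/-- The `Γ`-component of `y` in the decomposition `G = Ω Γ`. -/
def fib (y : G) : Γ :=
  ⟨(s.toFun (QuotientGroup.mk y))⁻¹ * y, QuotientGroup.eq.1 (s.mk_eq _)⟩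

theorem toFun_mul_fib (y : G) : s.toFun (QuotientGroup.mk y) * (s.fib y : G) = y := by
  simp [fib]

theorem mk_mul_coe (y : G) (γ : Γ) : (QuotientGroup.mk (y * γ) : G ⧸ Γ) = QuotientGroup.mk y := by
  rw [QuotientGroup.mk_mul_of_mem _ γ.2]

theorem fib_mul_coe (y : G) (γ : Γ) : s.fib (y * γ) = s.fib y * γ := by
  ext
  simp [fib, mul_assoc]

theorem fib_toFun (q : G ⧸ Γ) : s.fib (s.toFun q) = 1 := by
  ext
  simp [fib, s.mk_eq]

theorem mk_toFun_mul (q : G ⧸ Γ) (γ : Γ) : (QuotientGroup.mk (s.toFun q * γ) : G ⧸ Γ) = q := by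
  rw [mk_mul_coe, s.mk_eq]

theorem fib_toFun_mul (q : G ⧸ Γ) (γ : Γ) : s.fib (s.toFun q * γ) = γ := by
  rw [fib_mul_coe, fib_toFun, one_mul]

theorem fib_mul (x y : G) : s.fib (x * y) = s.fib (x * s.toFun (QuotientGroup.mk y)) * s.fib y := by
  rw [← fib_mul_coe, mul_assoc, toFun_mul_fib]

theorem mk_mul_toFun (x : G) (q : G ⧸ Γ) : (QuotientGroup.mk (x * s.toFun q) : G ⧸ Γ) = x • q := by
  conv_rhs => rw [← s.mk_eq q]
  rfl

theorem mul_toFun (x : G) (q : G ⧸ Γ) :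
    x * s.toFun q = s.toFun (x • q) * (s.fib (x * s.toFun q) : G) := by
  rw [← mk_mul_toFun, toFun_mul_fib]

/-- This is the cocycle identity for x⁻¹x = 1. It translates between the cocycle in the convolution
formula for φ̂ and the one in the regular representation. -/
theorem fib_inv_mul_toFun_smul (x : G) (q : G ⧸ Γ) :
    (s.fib (x⁻¹ * s.toFun (x • q)))⁻¹ = s.fib (x * s.toFun q) := by
  have : x⁻¹ * s.toFun (x • q) = s.toFun q * ((s.fib (x * s.toFun q))⁻¹ : Γ) := by
    rw [InvMemClass.coe_inv, eq_mul_inv_iff_mul_eq, mul_assoc, ← mul_toFun, inv_mul_cancel_left]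
  rw [this, fib_toFun_mul, inv_inv]

theorem mem_range_iff (y : G) : y ∈ Set.range s.toFun ↔ s.fib y = 1 := by
  constructor
  · rintro ⟨q, rfl⟩; exact s.fib_toFun q
  · intro h
    refine ⟨QuotientGroup.mk y, ?_⟩
    have := s.toFun_mul_fib y
    rwa [h, OneMemClass.coe_one, mul_one] at this

variable [MeasurableMul₂ G] [MeasurableInv G]

theorem measurable_fib : Measurable s.fib := by
  refine Measurable.subtype_mk ?_
  exact ((s.measurable.comp QuotientGroup.measurable_coe).inv).mul measurable_id

/-- The measurable isomorphism `G ≃ G ⧸ Γ × Γ` given by a Borel section. -/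
def equiv : G ≃ᵐ (G ⧸ Γ) × Γ where
  toFun y := (QuotientGroup.mk y, s.fib y)
  invFun p := s.toFun p.1 * p.2
  left_inv y := s.toFun_mul_fib y
  right_inv p := Prod.ext (s.mk_toFun_mul p.1 p.2) (s.fib_toFun_mul p.1 p.2)
  measurable_toFun := QuotientGroup.measurable_coe.prodMk s.measurable_fib
  measurable_invFun := (s.measurable.comp measurable_fst).mul (measurable_subtype_coe.comp measurable_snd)

theorem equiv_apply (y : G) : s.equiv y = (QuotientGroup.mk y, s.fib y) := rfl

theorem equiv_symm_apply (p : (G ⧸ Γ) × Γ) : s.equiv.symm p = s.toFun p.1 * p.2 := rfl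

end BorelSection

theorem measurableConstSMul_quotient [MeasurableMul G] (Γ : Subgroup G) :
    MeasurableConstSMul G (G ⧸ Γ) where
  measurable_const_smul c := by
    refine measurable_from_quotient.2 ?_
    exact QuotientGroup.measurable_coe.comp (measurable_const_mul c)

/-- A probability measure `ν` on `G ⧸ Γ` which is `G`-invariant and which is the quotient of `μ`. -/
structure IsQuotientMeasure [MeasurableMul₂ G] [MeasurableInv G] (s : BorelSection Γ) (μ : Measure G)
    (ν : Measure (G ⧸ Γ)) : Prop where
  prob : IsProbabilityMeasure ν
  invariant : SMulInvariantMeasure G (G ⧸ Γ) ν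
  measurePreserving : MeasurePreserving s.equiv μ (ν.prod Measure.count)

end BorelSection

/-! ### Disintegration of Haar measure, unimodularity, and the integral formula for φ̂ -/

section Haar

variable {G : Type*} [Group G] [TopologicalSpace G] [IsTopologicalGroup G]
    [LocallyCompactSpace G] [T2Space G] [SecondCountableTopology G]
    [MeasurableSpace G] [BorelSpace G] {Γ : Subgroup G} 

/-- The map is left translation by `x` in the coordinates of the section: the base measure is
invariant and each fibre is moved by a left translation of Γ. -/
theorem BorelSection.measurePreserving_skew [Countable Γ] (s : BorelSection Γ) (ν : Measure (G ⧸ Γ))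
    [IsFiniteMeasure ν] [SMulInvariantMeasure G (G ⧸ Γ) ν] (x : G) :
    MeasurePreserving (fun p : (G ⧸ Γ) × Γ => (x • p.1, s.fib (x * s.toFun p.1) * p.2))
      (ν.prod Measure.count) (ν.prod Measure.count) := by
  have := measurableConstSMul_quotient Γ
  refine (measurePreserving_smul x ν).skew_product
    (g := fun q γ => s.fib (x * s.toFun q) * γ) ?_ ?_
  · have h1 : Measurable fun q : G ⧸ Γ => s.fib (x * s.toFun q) :=
      s.measurable_fib.comp (s.measurable.const_mul x)
    exact (h1.comp measurable_fst).mul measurable_snd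
  · exact Filter.Eventually.of_forall fun q => (measurePreserving_mul_left _ _).map_eq

/-- Transporting ν × counting to G gives a left invariant measure, so uniqueness makes it a multiple
of `μ`. Evaluation on Ω, where `μ` is one, shows that the multiple is the mass of ν; dividing by it
gives the probability measure. -/
theorem exists_isQuotientMeasure (hΓ : IsLattice Γ) (s : BorelSection Γ) (μ : Measure G)
    [μ.IsHaarMeasure] (hμ : μ (Set.range s.toFun) = 1) :
    ∃ ν : Measure (G ⧸ Γ), IsQuotientMeasure s μ ν := by
  have := hΓ.discrete
  have : Countable Γ := countable_of_Lindelof_of_discrete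
  obtain ⟨ν, hfin, hne, hinv⟩ := hΓ.exists_invariant
  have := measurableConstSMul_quotient Γ
  have hrange : s.equiv.symm ⁻¹' (Set.range s.toFun) = Set.univ ×ˢ {1} := by
    ext p
    rw [Set.mem_preimage, s.mem_range_iff, s.equiv_symm_apply, s.fib_toFun_mul]
    simp
  let μ' : Measure G := (ν.prod Measure.count).map s.equiv.symm
  have hμ'range : μ' (Set.range s.toFun) = ν Set.univ := by
    rw [MeasurableEquiv.map_apply, hrange, Measure.prod_prod, Measure.count_singleton, mul_one]
  have : SigmaFinite μ' := s.equiv.symm.sigmaFinite_map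
  have : μ'.IsMulLeftInvariant := by
    refine ⟨fun x => ?_⟩
    rw [Measure.map_map (measurable_const_mul x) s.equiv.symm.measurable]
    have h1 : (fun y => x * y) ∘ s.equiv.symm =
        s.equiv.symm ∘ fun p : (G ⧸ Γ) × Γ => (x • p.1, s.fib (x * s.toFun p.1) * p.2) := by
      funext p
      simp only [Function.comp, s.equiv_symm_apply]
      rw [Subgroup.coe_mul, ← mul_assoc, ← mul_assoc, ← s.mul_toFun]
    rw [h1, ← Measure.map_map s.equiv.symm.measurable (s.measurePreserving_skew ν x).measurable,
      (s.measurePreserving_skew ν x).map_eq]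
  have h := measure_eq_div_smul μ' μ (s := Set.range s.toFun) (by rw [hμ]; simp) (by rw [hμ]; simp)
  rw [hμ'range, hμ, div_one] at h
  have hν0 : ν Set.univ ≠ 0 := by simpa using hne
  have hνt : ν Set.univ ≠ ∞ := measure_ne_top _ _
  have h2 : μ = (ν Set.univ)⁻¹ • μ' := by
    rw [h, smul_smul, ENNReal.inv_mul_cancel hν0 hνt, one_smul]
  refine ⟨(ν Set.univ)⁻¹ • ν, ⟨⟨by simp [ENNReal.inv_mul_cancel hν0 hνt]⟩, inferInstance,
    s.equiv.measurable, ?_⟩⟩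
  rw [h2, Measure.map_smul, Measure.prod_smul_left,
    Measure.map_map s.equiv.measurable s.equiv.symm.measurable]
  simp

theorem measurableSet_range [Countable Γ] (s : BorelSection Γ) : MeasurableSet (Set.range s.toFun) := by
  have : Set.range s.toFun = s.fib ⁻¹' {1} := by ext y; rw [s.mem_range_iff]; rfl
  rw [this]
  exact s.measurable_fib (measurableSet_singleton 1)

namespace IsQuotientMeasure

variable {s : BorelSection Γ} {μ : Measure G} {ν : Measure (G ⧸ Γ)} [Countable Γ]

theorem measurePreserving_mul_coe (h : IsQuotientMeasure s μ ν) (γ : Γ) :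
    MeasurePreserving (fun y : G => y * γ) μ μ := by
  have := h.prob
  have h1 : MeasurePreserving (Prod.map id fun δ : Γ => δ * γ) (ν.prod Measure.count)
      (ν.prod Measure.count) :=
    (MeasurePreserving.id ν).prod (measurePreserving_mul_right _ γ)
  have h2 := (h.measurePreserving.symm.comp h1).comp h.measurePreserving
  convert! h2 using 1
  funext y
  simp only [Function.comp, s.equiv_apply, s.equiv_symm_apply, Prod.map, id, Subgroup.coe_mul]
  rw [← mul_assoc, s.toFun_mul_fib]

variable [μ.IsHaarMeasure]

/-- A group with a lattice is unimodular. -/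
theorem measurePreserving_mul_right (h : IsQuotientMeasure s μ ν)
    (hμ : μ (Set.range s.toFun) = 1) (x : G) : MeasurePreserving (fun y : G => y * x) μ μ := by
  have := h.prob
  have := h.invariant
  have := measurableConstSMul_quotient Γ
  let D : G →* NNReal := Measure.modularCharacter
  have hD : ∀ g, μ.map (· * g) = D g • μ := fun g =>
    Measure.map_right_mul_eq_modularCharacterFun_smul μ g
  have hrm := measurableSet_range s
  have hDm : Measurable D := by
    -- Since μ(Ω) = 1, `D g` is the measure of {y | y g ∈ Ω}, a slice of a measurable set in G × G.
    have h1 : Measurable fun g => μ (Prod.mk g ⁻¹' ((fun p : G × G => p.2 * p.1) ⁻¹' Set.range s.toFun)) :=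
      measurable_measure_prodMk_left ((measurable_snd.mul measurable_fst) hrm)
    have h2 : ∀ g, μ (Prod.mk g ⁻¹' ((fun p : G × G => p.2 * p.1) ⁻¹' Set.range s.toFun)) = D g := by
      intro g
      have h3 := congrArg (fun m : Measure G => m (Set.range s.toFun)) (hD g)
      simp only [Measure.smul_apply, hμ] at h3
      rw [Measure.map_apply (measurable_mul_const g) hrm] at h3
      refine Eq.trans ?_ (h3.trans ?_)
      · rfl
      · simp [ENNReal.smul_def]
    simp_rw [h2] at h1
    exact (measurable_coe_nnreal_ennreal_iff.1 h1)
  have hDγ : ∀ γ : Γ, D γ = 1 := fun γ => by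
    have h1 := hD γ
    rw [(h.measurePreserving_mul_coe γ).map_eq] at h1
    have h3 := congrArg (fun m : Measure G => m (Set.range s.toFun)) h1
    simp only [Measure.smul_apply, hμ] at h3
    simpa [ENNReal.smul_def, eq_comm] using h3
  have hDs : ∀ y, D (s.toFun (QuotientGroup.mk y)) = D y := fun y => by
    conv_rhs => rw [← s.toFun_mul_fib y, map_mul, hDγ, mul_one]
  have hle : ∀ g, 1 ≤ D g → D g = 1 := by
    intro g hg
    -- As `D` is trivial on Γ it descends to G ⧸ Γ. The function 1/(1 + D) is bounded and hence
    -- integrable; for `D g ≥ 1` translation by `g` can only decrease it, while invariance keeps its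
    -- integral. So it is unchanged almost everywhere, forcing `D g = 1`.
    let F : G ⧸ Γ → ℝ≥0∞ := fun q => ((1 + D (s.toFun q))⁻¹ : NNReal)
    have hF : Measurable F := ((measurable_const.add (hDm.comp s.measurable)).inv).coe_nnreal_ennreal
    have hFg : ∀ q, F (g • q) = ((1 + D g * D (s.toFun q))⁻¹ : NNReal) := fun q => by
      simp only [F]
      rw [← s.mk_mul_toFun, hDs, map_mul]
    have hint : ∫⁻ q, F (g • q) ∂ν = ∫⁻ q, F q ∂ν := (measurePreserving_smul g ν).lintegral_comp hF
    have hF1 : ∀ q, F q ≤ 1 := fun q => by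
      simp only [F]
      exact_mod_cast inv_le_one_of_one_le₀ (le_add_of_nonneg_right zero_le)
    have hlefn : (fun q => F (g • q)) ≤ᵐ[ν] F := Filter.Eventually.of_forall fun q => by
      change F (g • q) ≤ F q
      rw [hFg]
      simp only [F]
      refine ENNReal.coe_le_coe.2 (inv_anti₀ (by positivity) ?_)
      gcongr
      exact le_mul_of_one_le_left zero_le hg
    have hae := ae_eq_of_ae_le_of_lintegral_le hlefn (by
      rw [hint]
      refine ne_top_of_le_ne_top (b := ∫⁻ _, 1 ∂ν) (by simp) (lintegral_mono hF1)) hF.aemeasurable hint.ge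
    obtain ⟨q, hq⟩ := hae.exists
    change F (g • q) = F q at hq
    rw [hFg] at hq
    simp only [F] at hq
    have h1 := inv_injective (ENNReal.coe_injective hq)
    have h2 : D g * D (s.toFun q) = 1 * D (s.toFun q) := by rw [one_mul]; exact add_left_cancel h1
    exact mul_right_cancel₀ (Measure.modularCharacterFun_pos _).ne' h2
  have hDx : D x = 1 := by
    rcases le_total 1 (D x) with h1 | h1
    · exact hle x h1
    · have h2 : D x * D x⁻¹ = 1 := by rw [← map_mul, mul_inv_cancel, map_one]
      have h3 : 1 ≤ D x⁻¹ := by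
        rw [← h2]; exact mul_le_of_le_one_left zero_le h1
      rw [hle _ h3, mul_one] at h2
      exact h2
  exact ⟨measurable_mul_const x, by rw [hD, hDx, one_smul]⟩

theorem measurePreserving_mk (h : IsQuotientMeasure s μ ν) :
    MeasurePreserving (QuotientGroup.mk : G → G ⧸ Γ) (μ.restrict (Set.range s.toFun)) ν := by
  have := h.prob
  refine ⟨QuotientGroup.measurable_coe, Measure.ext fun A hA => ?_⟩
  rw [Measure.map_apply QuotientGroup.measurable_coe hA,
    Measure.restrict_apply (QuotientGroup.measurable_coe hA)]
  have h1 : QuotientGroup.mk ⁻¹' A ∩ Set.range s.toFun = s.equiv ⁻¹' (A ×ˢ {1}) := by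
    ext y
    simp [s.mem_range_iff, s.equiv_apply]
  rw [h1, h.measurePreserving.measure_preimage
    (hA.prod (measurableSet_singleton 1)).nullMeasurableSet, Measure.prod_prod,
    Measure.count_singleton, mul_one]

theorem integral_smul_eq (h : IsQuotientMeasure s μ ν) {F : G ⧸ Γ → ℂ} (hF : Measurable F) (x : G) :
    ∫ q, F (x • q) ∂ν = ∫ q, F q ∂ν := by
  have := h.invariant
  have := measurableConstSMul_quotient Γ
  have h1 := measurePreserving_smul x ν
  conv_rhs => rw [← h1.map_eq]
  rw [integral_map h1.measurable.aemeasurable hF.aestronglyMeasurable]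

/-- Only γ = `fib y` contributes to the sum, so χ_Ω * φμ_Γ is φ ∘ `fib`. The factor χ̃_Ω restricts
the integral to xΩ, and left invariance moves it to Ω, a copy of (G ⧸ Γ, ν). The final substitution
q ↦ xq puts the cocycle in the form used by the regular representation. -/
theorem hat_eq (h : IsQuotientMeasure s μ ν) (φ : Γ → ℂ) (x : G) :
    hat μ Γ (Set.range s.toFun) φ x = ∫ q, φ (s.fib (x⁻¹ * s.toFun q))⁻¹ ∂ν := by
  have hφ : Measurable φ := measurable_of_countable φ
  have hm : ∀ x : G, Measurable fun q => s.fib (x * s.toFun q) := fun x =>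
    s.measurable_fib.comp (s.measurable.const_mul x)
  have hconv : ∀ y, convCount Γ (chi (Set.range s.toFun)) φ y = φ (s.fib y) := fun y => by
    rw [convCount, tsum_eq_single (s.fib y)]
    · have : y * (s.fib y : G)⁻¹ ∈ Set.range s.toFun := by
        rw [s.mem_range_iff, ← InvMemClass.coe_inv, s.fib_mul_coe, mul_inv_cancel]
      simp [chi, Set.indicator_of_mem this]
    · intro γ hγ
      have : y * (γ : G)⁻¹ ∉ Set.range s.toFun := by
        rw [s.mem_range_iff, ← InvMemClass.coe_inv, s.fib_mul_coe, mul_inv_eq_one]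
        exact hγ.symm
      simp only [chi, Set.indicator_of_notMem this, zero_mul]
  have htilde : ∀ y, tilde (chi (Set.range s.toFun)) (y⁻¹ * x) =
      (Set.range s.toFun).indicator 1 (x⁻¹ * y) := fun y => by
    simp only [tilde, chi, mul_inv_rev, inv_inv]
    by_cases hy : x⁻¹ * y ∈ Set.range s.toFun
    · simp [Set.indicator_of_mem hy]
    · simp [Set.indicator_of_notMem hy]
  calc hat μ Γ (Set.range s.toFun) φ x
      = ∫ y, φ (s.fib y) * (Set.range s.toFun).indicator 1 (x⁻¹ * y) ∂μ := by
        simp only [hat, conv, hconv, htilde]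
    _ = ∫ y, φ (s.fib (x * y)) * (Set.range s.toFun).indicator 1 y ∂μ := by
        rw [← integral_mul_left_eq_self _ x]
        simp
    _ = ∫ y in Set.range s.toFun, φ (s.fib (x * s.toFun (QuotientGroup.mk y))) ∂μ := by
        rw [← integral_indicator (measurableSet_range s)]
        congr 1
        funext y
        by_cases hy : y ∈ Set.range s.toFun
        · have h1 := (s.mem_range_iff y).1 hy
          rw [Set.indicator_of_mem hy, Set.indicator_of_mem hy, s.fib_mul x y, h1]
          simp
        · simp [Set.indicator_of_notMem hy]
    _ = ∫ q, φ (s.fib (x * s.toFun q)) ∂ν := by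
        conv_rhs => rw [← h.measurePreserving_mk.map_eq]
        rw [integral_map QuotientGroup.measurable_coe.aemeasurable]
        exact (hφ.comp (hm x)).aestronglyMeasurable
    _ = ∫ q, φ (s.fib (x⁻¹ * s.toFun q))⁻¹ ∂ν := by
        rw [← h.integral_smul_eq (F := fun q => φ (s.fib (x⁻¹ * s.toFun q))⁻¹)
          (hφ.comp (hm x⁻¹).inv) x]
        simp only [s.fib_inv_mul_toFun_smul]

end IsQuotientMeasure

end Haar

/-! ### Elementary tensors and multiplication operators on L² -/

section Tensor

variable {X Y : Type*} [MeasurableSpace X] [MeasurableSpace Y] {ν : Measure X} {ρ : Measure Y}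

theorem integrable_sq_norm (f : L2 ν) : Integrable (fun x => ‖f x‖ ^ 2) ν :=
  (memLp_two_iff_integrable_sq_norm (Lp.memLp f).1).1 (Lp.memLp f)

theorem memLp_tensor [SFinite ν] [SFinite ρ] (e : L2 ν) (f : L2 ρ) :
    MemLp (fun p : X × Y => e p.1 * f p.2) 2 (ν.prod ρ) := by
  have hm : AEStronglyMeasurable (fun p : X × Y => e p.1 * f p.2) (ν.prod ρ) :=
    (Lp.memLp e).1.comp_fst.mul (Lp.memLp f).1.comp_snd
  rw [memLp_two_iff_integrable_sq_norm hm]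
  simp only [norm_mul, mul_pow]
  exact (integrable_sq_norm e).mul_prod (integrable_sq_norm f)

/-- The elementary tensor `(x, y) ↦ e(x) f(y)` in `L²`. -/
def tensor [SFinite ν] [SFinite ρ] (e : L2 ν) (f : L2 ρ) : L2 (ν.prod ρ) := (memLp_tensor e f).toLp _

theorem coeFn_tensor [SFinite ν] [SFinite ρ] (e : L2 ν) (f : L2 ρ) :
    tensor e f =ᵐ[ν.prod ρ] fun p => e p.1 * f p.2 := MemLp.coeFn_toLp _

theorem inner_tensor [SFinite ν] [SFinite ρ] (e e' : L2 ν) (f f' : L2 ρ) :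
    (inner ℂ (tensor e f) (tensor e' f') : ℂ) = inner ℂ e e' * inner ℂ f f' := by
  rw [L2.inner_def, L2.inner_def, L2.inner_def, ← integral_prod_mul]
  refine integral_congr_ae ?_
  filter_upwards [coeFn_tensor e f, coeFn_tensor e' f'] with p h1 h2
  rw [h1, h2]
  simp only [RCLike.inner_apply, map_mul]
  ring

theorem norm_tensor [SFinite ν] [SFinite ρ] (e : L2 ν) (f : L2 ρ) : ‖tensor e f‖ = ‖e‖ * ‖f‖ := by
  have h := inner_tensor e e f f
  simp only [inner_self_eq_norm_sq_to_K] at h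
  have h2 : ‖tensor e f‖ ^ 2 = (‖e‖ * ‖f‖) ^ 2 := by
    rw [mul_pow]; exact_mod_cast h
  exact (sq_eq_sq₀ (norm_nonneg _) (by positivity)).1 h2

theorem ae_fst [SFinite ρ] {P : X → Prop} (h : ∀ᵐ x ∂ν, P x) : ∀ᵐ p ∂(ν.prod ρ), P p.1 :=
  Measure.quasiMeasurePreserving_fst.ae h

theorem ae_snd [SFinite ρ] {P : Y → Prop} (h : ∀ᵐ x ∂ρ, P x) : ∀ᵐ p ∂(ν.prod ρ), P p.2 :=
  Measure.quasiMeasurePreserving_snd.ae h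

theorem tensor_add_left [SFinite ν] [SFinite ρ] (e e' : L2 ν) (f : L2 ρ) :
    tensor (e + e') f = tensor e f + tensor e' f := by
  refine Lp.ext ?_
  filter_upwards [coeFn_tensor (e + e') f, coeFn_tensor e f, coeFn_tensor e' f,
    Lp.coeFn_add (tensor e f) (tensor e' f), ae_fst (Lp.coeFn_add e e')] with p h1 h2 h3 h4 h5
  rw [h1, h4, Pi.add_apply, h2, h3, h5, Pi.add_apply, add_mul]

theorem tensor_smul_left [SFinite ν] [SFinite ρ] (c : ℂ) (e : L2 ν) (f : L2 ρ) :
    tensor (c • e) f = c • tensor e f := by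
  refine Lp.ext ?_
  filter_upwards [coeFn_tensor (c • e) f, coeFn_tensor e f,
    Lp.coeFn_smul c (tensor e f), ae_fst (Lp.coeFn_smul c e)] with p h1 h2 h4 h5
  rw [h1, h4, Pi.smul_apply, h2, h5, Pi.smul_apply, smul_eq_mul, smul_eq_mul, mul_assoc]

theorem tensor_add_right [SFinite ν] [SFinite ρ] (e : L2 ν) (f f' : L2 ρ) :
    tensor e (f + f') = tensor e f + tensor e f' := by
  refine Lp.ext ?_
  filter_upwards [coeFn_tensor e (f + f'), coeFn_tensor e f, coeFn_tensor e f',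
    Lp.coeFn_add (tensor e f) (tensor e f'), ae_snd (Lp.coeFn_add f f')] with p h1 h2 h3 h4 h5
  rw [h1, h4, Pi.add_apply, h2, h3, h5, Pi.add_apply, mul_add]

theorem tensor_smul_right [SFinite ν] [SFinite ρ] (c : ℂ) (e : L2 ν) (f : L2 ρ) :
    tensor e (c • f) = c • tensor e f := by
  refine Lp.ext ?_
  filter_upwards [coeFn_tensor e (c • f), coeFn_tensor e f,
    Lp.coeFn_smul c (tensor e f), ae_snd (Lp.coeFn_smul c f)] with p h1 h2 h4 h5
  rw [h1, h4, Pi.smul_apply, h2, h5, Pi.smul_apply, smul_eq_mul, smul_eq_mul, mul_left_comm]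

/-- Multiplication by a bounded measurable function, as an operator on `L²`. -/
def mulOp {w : X → ℂ} {C : ℝ} (hw : Measurable w) (hC : ∀ x, ‖w x‖ ≤ C) : L2 ν →L[ℂ] L2 ν :=
  (ContinuousLinearMap.lsmul ℂ ℂ).holderL ν ∞ 2 2
    ((memLp_top_of_bound hw.aestronglyMeasurable C (Filter.Eventually.of_forall hC)).toLp w)

theorem coeFn_mulOp {w : X → ℂ} {C : ℝ} (hw : Measurable w) (hC : ∀ x, ‖w x‖ ≤ C) (f : L2 ν) :
    mulOp hw hC f =ᵐ[ν] fun x => w x * f x := by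
  have h1 := (ContinuousLinearMap.lsmul ℂ ℂ).coeFn_holder (r := 2) 
    ((memLp_top_of_bound hw.aestronglyMeasurable C (Filter.Eventually.of_forall hC)).toLp w) f
  filter_upwards [h1, MemLp.coeFn_toLp (memLp_top_of_bound (μ := ν) hw.aestronglyMeasurable C
    (Filter.Eventually.of_forall hC))] with x h1 h2
  refine Eq.trans h1 ?_
  rw [h2]; rfl

theorem inner_mulOp {w : X → ℂ} {C : ℝ} (hw : Measurable w) (hC : ∀ x, ‖w x‖ ≤ C) (f g : L2 ν) :
    (inner ℂ g (mulOp hw hC f) : ℂ) = ∫ x, w x * inner ℂ (g x) (f x) ∂ν := by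
  rw [L2.inner_def]
  refine integral_congr_ae ?_
  filter_upwards [coeFn_mulOp hw hC f] with x hx
  rw [hx]
  simp only [RCLike.inner_apply]
  ring

theorem integrable_mul_inner {w : X → ℂ} {C : ℝ} (hw : Measurable w) (hC : ∀ x, ‖w x‖ ≤ C) (f g : L2 ν) :
    Integrable (fun x => w x * inner ℂ (g x) (f x)) ν :=
  (L2.integrable_inner (𝕜 := ℂ) g f).bdd_mul hw.aestronglyMeasurable (Filter.Eventually.of_forall hC)

end Tensor

/-! ### The factorization L²(G) = L²(G ⧸ Γ) ⊗ ℓ²(Γ) -/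

section FundamentalDomain

variable {G : Type*} [Group G] [MeasurableSpace G] [MeasurableMul₂ G] [MeasurableInv G]
  {Γ : Subgroup G} [Countable Γ] [MeasurableSingletonClass Γ] {s : BorelSection Γ} {μ : Measure G}
  {ν : Measure (G ⧸ Γ)}

namespace IsQuotientMeasure

/-- The map `L²(G ⧸ Γ) × ℓ²(Γ) → L²(G)` given by `(e, f) ↦ (σ(q) γ ↦ e(q) f(γ))`. -/
def lift (h : IsQuotientMeasure s μ ν) : L2 ν →L[ℂ] L2 (Measure.count : Measure Γ) →L[ℂ] L2 μ :=
  haveI := h.prob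
  LinearMap.mkContinuous₂
    (LinearMap.mk₂ ℂ (fun e f => Lp.compMeasurePreservingₗᵢ ℂ s.equiv h.measurePreserving (tensor e f))
      (fun e e' f => by rw [tensor_add_left, map_add])
      (fun c e f => by rw [tensor_smul_left, map_smul])
      (fun e f f' => by rw [tensor_add_right, map_add])
      (fun c e f => by rw [tensor_smul_right, map_smul])) 1
    (fun e f => by
      refine le_of_eq ?_
      rw [LinearMap.mk₂_apply, LinearIsometry.norm_map, norm_tensor, one_mul])

theorem inner_lift (h : IsQuotientMeasure s μ ν) (e e' : L2 ν) (f f' : L2 (Measure.count : Measure Γ)) :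
    (inner ℂ (h.lift e f) (h.lift e' f') : ℂ) = inner ℂ e e' * inner ℂ f f' := by
  have := h.prob
  rw [← inner_tensor]
  let U : L2 (ν.prod (Measure.count : Measure Γ)) →ₗᵢ[ℂ] L2 μ :=
    Lp.compMeasurePreservingₗᵢ ℂ s.equiv h.measurePreserving
  exact U.inner_map_map _ _

theorem norm_lift (h : IsQuotientMeasure s μ ν) (e : L2 ν) (f : L2 (Measure.count : Measure Γ)) :
    ‖h.lift e f‖ = ‖e‖ * ‖f‖ := by
  have := h.prob
  rw [← norm_tensor]
  exact LinearIsometry.norm_map (Lp.compMeasurePreservingₗᵢ ℂ s.equiv h.measurePreserving) _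

theorem coeFn_lift (h : IsQuotientMeasure s μ ν) (e : L2 ν) (f : L2 (Measure.count : Measure Γ)) :
    h.lift e f =ᵐ[μ] fun y => e (QuotientGroup.mk y) * f (s.fib y) := by
  have := h.prob
  have h1 : h.lift e f =ᵐ[μ] tensor e f ∘ s.equiv :=
    Lp.coeFn_compMeasurePreserving (tensor e f) h.measurePreserving
  filter_upwards [h1, h.measurePreserving.quasiMeasurePreserving.ae (coeFn_tensor e f)] with y h1 h2
  rw [h1, Function.comp, h2]
  rfl

theorem ae_mk (h : IsQuotientMeasure s μ ν) {P : G ⧸ Γ → Prop} (hP : ∀ᵐ q ∂ν, P q) :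
    ∀ᵐ y ∂μ, P (QuotientGroup.mk y) := by
  have := h.prob
  exact h.measurePreserving.quasiMeasurePreserving.ae (ae_fst hP)

theorem integral_eq (h : IsQuotientMeasure s μ ν) {F : G → ℂ} (hF : Integrable F μ) :
    ∫ y, F y ∂μ = ∫ q, ∫ γ : Γ, F (s.toFun q * γ) ∂Measure.count ∂ν := by
  have := h.prob
  have h1 := h.measurePreserving.symm
  have h2 : Integrable (fun p => F (s.equiv.symm p)) (ν.prod Measure.count) :=
    (h1.integrable_comp_emb s.equiv.symm.measurableEmbedding).2 hF
  rw [← h1.integral_comp s.equiv.symm.measurableEmbedding F, integral_prod _ h2]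
  rfl

/-- Matrix coefficients of the left regular representation of `G` at vectors `e ⊗ f`. -/
theorem integral_mul_inner_leftReg_lift [μ.IsMulLeftInvariant] (h : IsQuotientMeasure s μ ν)
    {w : G ⧸ Γ → ℂ} {C : ℝ}
    (hw : Measurable w) (hC : ∀ q, ‖w q‖ ≤ C) (x : G) (e e' : L2 ν)
    (f f' : L2 (Measure.count : Measure Γ)) :
    ∫ y, w (QuotientGroup.mk y) * inner ℂ (h.lift e' f' y) (leftReg μ x (h.lift e f) y) ∂μ =
      ∫ q, w q * inner ℂ (e' q) (e (x⁻¹ • q)) *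
        inner ℂ f' (leftReg Measure.count (s.fib (x⁻¹ * s.toFun q))⁻¹ f) ∂ν := by
  have hint := integrable_mul_inner (ν := μ) (hw.comp (QuotientGroup.measurable_coe (S := Γ)))
    (fun y => hC (QuotientGroup.mk y)) (leftReg μ x (h.lift e f)) (h.lift e' f')
  let F : G → ℂ := fun y => w (QuotientGroup.mk y) *
    inner ℂ (e' (QuotientGroup.mk y) * f' (s.fib y))
      (e (x⁻¹ • (QuotientGroup.mk y : G ⧸ Γ)) * f (s.fib (x⁻¹ * y)))
  have hae : (fun y => w (QuotientGroup.mk y) *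
      inner ℂ (h.lift e' f' y) (leftReg μ x (h.lift e f) y)) =ᵐ[μ] F := by
    have h2 := (measurePreserving_mul_left μ x⁻¹).quasiMeasurePreserving.ae (h.coeFn_lift e f)
    filter_upwards [h.coeFn_lift e' f', coeFn_leftReg μ x (h.lift e f), h2] with y h1 h2 h3
    rw [h1, h2, h3]
    rfl
  rw [integral_congr_ae hae, h.integral_eq (hint.congr hae)]
  refine integral_congr_ae (Filter.Eventually.of_forall fun q => ?_)
  simp only [F, s.mk_toFun_mul, s.fib_toFun_mul]
  rw [L2.inner_def, ← integral_const_mul]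
  refine integral_congr_ae ?_
  filter_upwards [coeFn_leftReg Measure.count (s.fib (x⁻¹ * s.toFun q))⁻¹ f] with γ hγ
  rw [hγ, inv_inv, ← mul_assoc, s.fib_mul_coe]
  simp only [RCLike.inner_apply, map_mul]
  ring

theorem inner_leftReg_lift [μ.IsMulLeftInvariant] (h : IsQuotientMeasure s μ ν) (x : G) (e e' : L2 ν)
    (f f' : L2 (Measure.count : Measure Γ)) :
    inner ℂ (h.lift e' f') (leftReg μ x (h.lift e f)) =
      ∫ q, inner ℂ (e' q) (e (x⁻¹ • q)) *
        inner ℂ f' (leftReg Measure.count (s.fib (x⁻¹ * s.toFun q))⁻¹ f) ∂ν := by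
  have := h.integral_mul_inner_leftReg_lift (w := 1) (C := 1) measurable_one (by simp) x e e' f f'
  simpa [L2.inner_def] using this

theorem measurePreserving_slice (h : IsQuotientMeasure s μ ν) (γ : Γ) :
    MeasurePreserving (fun q => s.toFun q * (γ : G)) ν (μ.restrict (s.fib ⁻¹' {γ})) := by
  have := h.prob
  have hm : Measurable fun q => s.toFun q * (γ : G) := s.measurable.mul_const _
  refine ⟨hm, Measure.ext fun A hA => ?_⟩
  rw [Measure.map_apply hm hA, Measure.restrict_apply hA]
  have h1 : A ∩ s.fib ⁻¹' {γ} = s.equiv ⁻¹' (((fun q => s.toFun q * (γ : G)) ⁻¹' A) ×ˢ {γ}) := by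
    ext y
    simp only [Set.mem_inter_iff, Set.mem_preimage, Set.mem_singleton_iff, s.equiv_apply, Set.mem_prod]
    constructor
    · rintro ⟨h1, rfl⟩
      exact ⟨by rwa [s.toFun_mul_fib], rfl⟩
    · rintro ⟨h1, rfl⟩
      exact ⟨by rwa [s.toFun_mul_fib] at h1, rfl⟩
  rw [h1, h.measurePreserving.measure_preimage
    ((hm hA).prod (measurableSet_singleton γ)).nullMeasurableSet, Measure.prod_prod,
    Measure.count_singleton, mul_one]

/-- Testing `u` against e ⊗ δ_γ, with `e` the restriction of `u` itself to the slice Ωγ, gives the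
integral of |u|² over that slice; countably many slices cover G. -/
theorem eq_zero_of_inner_lift_eq_zero (h : IsQuotientMeasure s μ ν) {u : L2 μ}
    (hu : ∀ e f, (inner ℂ (h.lift e f) u : ℂ) = 0) : u = 0 := by
  have := h.prob
  have key : ∀ γ : Γ, ∀ᵐ y ∂μ, s.fib y = γ → u y = 0 := by
    intro γ
    have hmem : MemLp (fun q => u (s.toFun q * γ)) 2 ν :=
      ((Lp.memLp u).restrict _).comp_measurePreserving (h.measurePreserving_slice γ)
    let e : L2 ν := hmem.toLp _
    let δ : L2 (Measure.count : Measure Γ) :=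
      indicatorConstLp 2 (measurableSet_singleton γ) (by simp) 1
    have h0 := hu e δ
    rw [L2.inner_def] at h0
    have hae : (fun y => (inner ℂ (h.lift e δ y) (u y) : ℂ)) =ᵐ[μ]
        fun y => (((s.fib ⁻¹' {γ}).indicator (fun y => ‖u y‖ ^ 2) y : ℝ) : ℂ) := by
      have hδ : ∀ γ', δ γ' = ({γ} : Set Γ).indicator (fun _ => (1 : ℂ)) γ' :=
        Measure.ae_count_iff.1 indicatorConstLp_coeFn
      filter_upwards [h.coeFn_lift e δ, h.ae_mk hmem.coeFn_toLp] with y h1 h2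
      rw [h1, h2, hδ]
      by_cases hy : s.fib y = γ
      · have h3 : s.toFun (QuotientGroup.mk y) * (γ : G) = y := by rw [← hy, s.toFun_mul_fib]
        rw [Set.indicator_of_mem (by exact hy), Set.indicator_of_mem (by exact hy), h3, mul_one,
          inner_self_eq_norm_sq_to_K]
        simp
      · rw [Set.indicator_of_notMem (by exact hy), Set.indicator_of_notMem (by exact hy)]
        simp
    rw [integral_congr_ae hae, integral_complex_ofReal, Complex.ofReal_eq_zero,
      integral_eq_zero_iff_of_nonneg] at h0
    · filter_upwards [h0] with y hy hyγ
      rw [Set.indicator_of_mem (by exact hyγ)] at hy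
      simpa using hy
    · intro y
      exact Set.indicator_nonneg (fun _ _ => by positivity) y
    · exact (integrable_sq_norm u).indicator (s.measurable_fib (measurableSet_singleton γ))
  refine (Lp.eq_zero_iff_ae_eq_zero).2 ?_
  filter_upwards [ae_all_iff.2 key] with y hy
  exact hy _ rfl

end IsQuotientMeasure

end FundamentalDomain

/-! ### Amplifying a completely bounded map along orthogonal isometries -/

section Amplification

variable {ι K H : Type*} [NormedAddCommGroup K] [InnerProductSpace ℂ K] [CompleteSpace K]
  [NormedAddCommGroup H] [InnerProductSpace ℂ H] [CompleteSpace H]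

/-- Isometries with pairwise orthogonal ranges. -/
def IsOrthIsometries (V : ι → K →L[ℂ] H) : Prop :=
  (∀ i f g, (inner ℂ (V i f) (V i g) : ℂ) = inner ℂ f g) ∧
    ∀ i j f g, i ≠ j → (inner ℂ (V i f) (V j g) : ℂ) = 0

namespace IsOrthIsometries

variable {V : ι → K →L[ℂ] H} 

theorem norm_sq_sum (hV : IsOrthIsometries V) (F : Finset ι) (x : ι → K) :
    ‖∑ i ∈ F, V i (x i)‖ ^ 2 = ∑ i ∈ F, ‖x i‖ ^ 2 := by
  have h : (inner ℂ (∑ i ∈ F, V i (x i)) (∑ i ∈ F, V i (x i)) : ℂ) = ∑ i ∈ F, inner ℂ (x i) (x i) := by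
    rw [sum_inner]
    refine Finset.sum_congr rfl fun i hi => ?_
    rw [inner_sum, Finset.sum_eq_single i, hV.1]
    · intro j _ hj; exact hV.2 _ _ _ _ hj.symm
    · intro hi'; exact absurd hi hi'
  simp only [inner_self_eq_norm_sq_to_K] at h
  exact_mod_cast h

theorem sum_norm_sq_adjoint_le (hV : IsOrthIsometries V) (F : Finset ι) (u : H) :
    ∑ i ∈ F, ‖ContinuousLinearMap.adjoint (V i) u‖ ^ 2 ≤ ‖u‖ ^ 2 := by
  set x : ι → K := fun i => ContinuousLinearMap.adjoint (V i) u
  have h1 : (inner ℂ (∑ i ∈ F, V i (x i)) u : ℂ) = ∑ i ∈ F, inner ℂ (x i) (x i) := by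
    rw [sum_inner]
    refine Finset.sum_congr rfl fun i _ => ?_
    rw [← ContinuousLinearMap.adjoint_inner_right]
  have h2 : ‖(inner ℂ (∑ i ∈ F, V i (x i)) u : ℂ)‖ = ∑ i ∈ F, ‖x i‖ ^ 2 := by
    rw [h1]
    simp only [inner_self_eq_norm_sq_to_K]
    have : (∑ i ∈ F, ((‖x i‖ : ℝ) : ℂ) ^ 2) = ((∑ i ∈ F, ‖x i‖ ^ 2 : ℝ) : ℂ) := by push_cast; rfl
    refine (congrArg norm this).trans ?_
    rw [Complex.norm_real, Real.norm_of_nonneg (Finset.sum_nonneg fun _ _ => by positivity)]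
  have h3 := norm_inner_le_norm (𝕜 := ℂ) (∑ i ∈ F, V i (x i)) u
  rw [h2, ← hV.norm_sq_sum F x] at h3
  rw [← hV.norm_sq_sum F x]
  rcases eq_or_ne ‖∑ i ∈ F, V i (x i)‖ 0 with h0 | h0
  · rw [h0]; simp
  · have hpos : 0 < ‖∑ i ∈ F, V i (x i)‖ := lt_of_le_of_ne (norm_nonneg _) h0.symm
    have : ‖∑ i ∈ F, V i (x i)‖ ≤ ‖u‖ := by
      rw [sq] at h3; exact le_of_mul_le_mul_left h3 hpos
    gcongr

end IsOrthIsometries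

/-- The matrix entries `V i ^* T V j` of the operators of an algebra `M`, if they lie in the
algebra `N`. -/
def entry (V : ι → K →L[ℂ] H) (M : StarSubalgebra ℂ (H →L[ℂ] H)) (N : StarSubalgebra ℂ (K →L[ℂ] K))
    (hVM : ∀ i j, ∀ T ∈ M, ContinuousLinearMap.adjoint (V i) ∘L T ∘L V j ∈ N) (i j : ι) : M →ₗ[ℂ] N where
  toFun T := ⟨ContinuousLinearMap.adjoint (V i) ∘L (T : H →L[ℂ] H) ∘L V j, hVM i j T T.2⟩
  map_add' T T' := by ext; simp
  map_smul' c T := by ext; simp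

variable {V : ι → K →L[ℂ] H} {M : StarSubalgebra ℂ (H →L[ℂ] H)} {N : StarSubalgebra ℂ (K →L[ℂ] K)}
  (hVM : ∀ i j, ∀ T ∈ M, ContinuousLinearMap.adjoint (V i) ∘L T ∘L V j ∈ N)

theorem coe_entry (i j : ι) (T : M) : (entry V M N hVM i j T : K →L[ℂ] K) =
    ContinuousLinearMap.adjoint (V i) ∘L (T : H →L[ℂ] H) ∘L V j := rfl

/-- The compression of the amplification of `Φ` to finitely many coordinates, as a form. -/
def partialForm (Φ : N →ₗ[ℂ] N) (F : Finset ι) (v u : H) (T : M) : ℂ :=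
  ∑ i ∈ F, ∑ j ∈ F, inner ℂ (ContinuousLinearMap.adjoint (V i) v)
    ((Φ (entry V M N hVM i j T) : K →L[ℂ] K) (ContinuousLinearMap.adjoint (V j) u))

/-- The vectors u(l, j), j ∈ F, are glued to ∑ⱼ V j u(l, j). Orthogonality of the ranges preserves
the total square norm, so the bound for `T` applies directly. -/
theorem formBound_entry (hV : IsOrthIsometries V) {κ : Type*} [Fintype κ] {T : κ → κ → M} {c : ℝ}
    (h : FormBound (fun k l => (T k l : H →L[ℂ] H)) c) (F : Finset ι) :
    FormBound (fun k l : κ × F => (entry V M N hVM k.2 l.2 (T k.1 l.1) : K →L[ℂ] K)) c := by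
  intro u v
  let u' : κ → H := fun l => ∑ j : F, V j (u (l, j))
  let v' : κ → H := fun l => ∑ j : F, V j (v (l, j))
  have hu : ∀ u : κ × F → K, ∑ l, ‖∑ j : F, V j (u (l, j))‖ ^ 2 = ∑ l, ‖u l‖ ^ 2 := fun u => by
    rw [Fintype.sum_prod_type]
    refine Finset.sum_congr rfl fun l _ => ?_
    have hV' : IsOrthIsometries (fun j : F => V j) :=
      ⟨fun i => hV.1 i, fun i j f g hij => hV.2 i j f g (Subtype.coe_injective.ne hij)⟩
    exact hV'.norm_sq_sum Finset.univ fun j => u (l, j)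
  have h1 := h u' v'
  simp only [u', v'] at h1
  rw [hu u, hu v] at h1
  convert! h1 using 2
  simp only [Fintype.sum_prod_type, map_sum, sum_inner, inner_sum, coe_entry,
    ContinuousLinearMap.comp_apply, ContinuousLinearMap.adjoint_inner_right]
  refine Finset.sum_congr rfl fun k _ => ?_
  rw [Finset.sum_comm]
  exact Finset.sum_congr rfl fun l _ => Finset.sum_comm

theorem norm_sum_partialForm_le (hV : IsOrthIsometries V) {Φ : N →ₗ[ℂ] N} {C : ℝ} (hC : 0 ≤ C)
    (hΦ : CBBound Φ C) {κ : Type*} [Fintype κ] {T : κ → κ → M} {c : ℝ}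
    (hc : 0 ≤ c) (h : FormBound (fun k l => (T k l : H →L[ℂ] H)) c) (F : Finset ι) (u v : κ → H) :
    ‖∑ k, ∑ l, partialForm hVM Φ F (v k) (u l) (T k l)‖ ≤
      C * c * (√(∑ k, ‖u k‖ ^ 2) * √(∑ k, ‖v k‖ ^ 2)) := by
  have h1 := hΦ.formBound hC (fun k l : κ × F => entry V M N hVM k.2 l.2 (T k.1 l.1)) hc
    (formBound_entry hVM hV h F) (fun l => ContinuousLinearMap.adjoint (V l.2) (u l.1))
    (fun l => ContinuousLinearMap.adjoint (V l.2) (v l.1))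
  have hle : ∀ u : κ → H, √(∑ k : κ × F, ‖ContinuousLinearMap.adjoint (V k.2) (u k.1)‖ ^ 2) ≤
      √(∑ k, ‖u k‖ ^ 2) := fun u => by
    refine Real.sqrt_le_sqrt ?_
    rw [Fintype.sum_prod_type]
    refine Finset.sum_le_sum fun k _ => ?_
    rw [Finset.sum_coe_sort F fun i => ‖ContinuousLinearMap.adjoint (V i) (u k)‖ ^ 2]
    exact hV.sum_norm_sq_adjoint_le F (u k)
  have h2 : ∑ k, ∑ l, partialForm hVM Φ F (v k) (u l) (T k l) = ∑ k : κ × F, ∑ l : κ × F,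
      inner ℂ (ContinuousLinearMap.adjoint (V k.2) (v k.1))
        ((Φ (entry V M N hVM k.2 l.2 (T k.1 l.1)) : K →L[ℂ] K)
          (ContinuousLinearMap.adjoint (V l.2) (u l.1))) := by
    simp only [Fintype.sum_prod_type, partialForm]
    refine Finset.sum_congr rfl fun k _ => ?_
    rw [Finset.sum_comm]
    rw [← Finset.sum_coe_sort F]
    refine Finset.sum_congr rfl fun i _ => Finset.sum_congr rfl fun l _ => ?_
    exact (Finset.sum_coe_sort F fun j => (inner ℂ (ContinuousLinearMap.adjoint (V i) (v k))
      ((Φ (entry V M N hVM i j (T k l)) : K →L[ℂ] K) (ContinuousLinearMap.adjoint (V j) (u l))) : ℂ)).symm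
  rw [h2]
  refine h1.trans ?_
  exact mul_le_mul_of_nonneg_left (mul_le_mul (hle u) (hle v) (Real.sqrt_nonneg _) (Real.sqrt_nonneg _))
    (mul_nonneg hC hc)

/-- The finite compressions are uniformly bounded because Φ is completely bounded. Their limit along
an ultrafilter inherits sesquilinearity and the matrix bounds, so no convergence of the net has to
be proved. -/
theorem exists_amplification (hV : IsOrthIsometries V) {Φ : N →ₗ[ℂ] N} {C : ℝ} (hC : 0 ≤ C)
    (hΦ : CBBound Φ C) : ∃ Λ : H →L⋆[ℂ] H →L[ℂ] (M →L[ℂ] ℂ),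
      (∀ i j f g T, Λ (V i g) (V j f) T = inner ℂ g ((Φ (entry V M N hVM i j T) : K →L[ℂ] K) f)) ∧
      ∀ (n : ℕ) (T : Fin n → Fin n → M) (c : ℝ), 0 ≤ c →
        FormBound (fun k l => (T k l : H →L[ℂ] H)) c → ∀ u v : Fin n → H,
          ‖∑ k, ∑ l, Λ (v k) (u l) (T k l)‖ ≤ C * c * (√(∑ k, ‖u k‖ ^ 2) * √(∑ k, ‖v k‖ ^ 2)) := by
  classical
  let 𝒰 : Ultrafilter (Finset ι) := Ultrafilter.of atTop
  have h𝒰 : (𝒰 : Filter (Finset ι)) ≤ atTop := Ultrafilter.of_le _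
  have hbound : ∀ F v u T, ‖partialForm hVM Φ F v u T‖ ≤ C * ‖v‖ * ‖u‖ * ‖T‖ := fun F v u T => by
    have h1 : FormBound (fun _ _ : Unit => (T : H →L[ℂ] H)) ‖(T : H →L[ℂ] H)‖ := fun u v => by
      simpa using norm_inner_apply_le (T : H →L[ℂ] H) (u ()) (v ())
    have h2 := norm_sum_partialForm_le hVM hV hC hΦ (T := fun _ _ : Unit => T) (norm_nonneg _) h1 F
      (fun _ => u) (fun _ => v)
    simp only [Finset.univ_unique, Finset.sum_const, Finset.card_singleton, one_smul,
      Real.sqrt_sq (norm_nonneg _)] at h2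
    refine h2.trans (le_of_eq ?_)
    change C * ‖T‖ * (‖u‖ * ‖v‖) = _
    ring
  have hlim : ∀ v u T, ∃ L, Tendsto (fun F => partialForm hVM Φ F v u T) 𝒰 (𝓝 L) := fun v u T => by
    have hc := isCompact_closedBall (0 : ℂ) (C * ‖v‖ * ‖u‖ * ‖T‖)
    obtain ⟨L, -, hL⟩ := hc.ultrafilter_le_nhds
      (𝒰.map fun F => partialForm hVM Φ F v u T) (by
        rw [Ultrafilter.coe_map, le_principal_iff, mem_map]
        exact Filter.univ_mem' fun F => by simpa using hbound F v u T)
    exact ⟨L, hL⟩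
  choose L hL using hlim
  have huniq : ∀ {v u T z}, Tendsto (fun F => partialForm hVM Φ F v u T) 𝒰 (𝓝 z) → L v u T = z :=
    fun h => tendsto_nhds_unique (hL _ _ _) h
  have hLb : ∀ v u T, ‖L v u T‖ ≤ C * ‖v‖ * ‖u‖ * ‖T‖ := fun v u T =>
    le_of_tendsto (hL v u T).norm (Eventually.of_forall fun F => hbound F v u T)
  let L0 : H → H → M →L[ℂ] ℂ := fun v u => LinearMap.mkContinuous
    { toFun := L v u
      map_add' := fun T T' => huniq (((hL v u T).add (hL v u T')).congr fun F => by
        simp [partialForm, Finset.sum_add_distrib])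
      map_smul' := fun c T => huniq (((hL v u T).const_mul c).congr fun F => by
        simp [partialForm, Finset.mul_sum]) } (C * ‖v‖ * ‖u‖) (hLb v u)
  let Λ : H →L⋆[ℂ] H →L[ℂ] (M →L[ℂ] ℂ) := LinearMap.mkContinuous₂
    (LinearMap.mk₂'ₛₗ (starRingEnd ℂ) (RingHom.id ℂ) L0
      (fun v v' u => by
        ext T
        exact huniq (((hL v u T).add (hL v' u T)).congr fun F => by
          simp [partialForm, Finset.sum_add_distrib]))
      (fun c v u => by
        ext T
        exact huniq (((hL v u T).const_mul _).congr fun F => by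
          simp [partialForm, Finset.mul_sum, mul_comm]))
      (fun v u u' => by
        ext T
        exact huniq (((hL v u T).add (hL v u' T)).congr fun F => by
          simp [partialForm, Finset.sum_add_distrib]))
      (fun c v u => by
        ext T
        exact huniq (((hL v u T).const_mul _).congr fun F => by
          simp [partialForm, Finset.mul_sum]))) C
    (fun v u => LinearMap.mkContinuous_norm_le _ (by positivity) (hLb v u))
  have hΛ : ∀ v u T, Λ v u T = L v u T := fun _ _ _ => rfl
  refine ⟨Λ, fun i j f g T => ?_, fun n T c hc hT u v => ?_⟩
  · rw [hΛ]
    refine huniq (tendsto_const_nhds.congr' ?_)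
    -- On the ranges of `V i` and `V j` the compressions are constant once F contains i and j, so
    -- the limit is explicit there.
    have hev : ∀ᶠ F : Finset ι in atTop, {i, j} ⊆ F := eventually_ge_atTop _
    filter_upwards [h𝒰 hev] with F hF
    have hi : i ∈ F := hF (by simp)
    have hj : j ∈ F := hF (by simp)
    have had : ∀ k l f, ContinuousLinearMap.adjoint (V k) (V l f) = if k = l then f else 0 := by
      intro k l f
      refine ext_inner_left ℂ fun g => ?_
      rw [ContinuousLinearMap.adjoint_inner_right]
      split_ifs with hkl
      · subst hkl; exact hV.1 _ _ _
      · rw [inner_zero_right]; exact hV.2 _ _ _ _ hkl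
    rw [partialForm, Finset.sum_eq_single i, Finset.sum_eq_single j]
    · simp [had]
    · intro k _ hk; simp [had, hk]
    · exact fun h => absurd hj h
    · intro k _ hk; simp [had, hk]
    · exact fun h => absurd hi h
  · have h1 : Tendsto (fun F => ∑ k, ∑ l, partialForm hVM Φ F (v k) (u l) (T k l)) 𝒰
        (𝓝 (∑ k, ∑ l, Λ (v k) (u l) (T k l))) :=
      tendsto_finsetSum _ fun k _ => tendsto_finsetSum _ fun l _ => hL _ _ _
    exact le_of_tendsto h1.norm (Eventually.of_forall fun F =>
      norm_sum_partialForm_le hVM hV hC hΦ hc hT F u v)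

end Amplification

/-! ### Extending closed linear conditions from a dense set of vectors -/

section Dense

variable {ι K H : Type*} [NormedAddCommGroup K] [InnerProductSpace ℂ K]
  [NormedAddCommGroup H] [InnerProductSpace ℂ H] {V : ι → K →L[ℂ] H}

/-- The ranges of the operators `V i` span a dense subspace. -/
def SpansDense (V : ι → K →L[ℂ] H) : Prop :=
  ∀ W : Submodule ℂ H, IsClosed (W : Set H) → (∀ i f, V i f ∈ W) → W = ⊤

/-- Closed linear conditions on a sesquilinear map extend from a dense set of vectors. -/
theorem SpansDense.mem_of_forall {E : Type*} [NormedAddCommGroup E] [NormedSpace ℂ E]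
    (hV : SpansDense V) (Λ : H →L⋆[ℂ] H →L[ℂ] E) (W : Submodule ℂ E) (hW : IsClosed (W : Set E))
    (h : ∀ i j f g, Λ (V i g) (V j f) ∈ W) (v u : H) : Λ v u ∈ W := by
  have h1 : ∀ i g u, Λ (V i g) u ∈ W := fun i g u => by
    have := hV (W.comap (Λ (V i g)).toLinearMap) (hW.preimage (Λ (V i g)).continuous)
      (fun j f => h i j f g)
    exact (Submodule.eq_top_iff'.1 this) u
  have := hV (W.comap (Λ.flip u).toLinearMap) (hW.preimage (Λ.flip u).continuous)
      (fun i g => h1 i g u)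
  exact (Submodule.eq_top_iff'.1 this) v

end Dense

/-! ### Coefficients of λ and transposed multiplication operators -/

section Coefficients

variable {G : Type*} [Group G] [MeasurableSpace G] [MeasurableMul G]
  {μ : Measure G} [μ.IsMulLeftInvariant]

variable (μ) in
theorem groupVN_eq : groupVN μ = StarSubalgebra.centralizer ℂ
    (StarSubalgebra.centralizer ℂ (Set.range (leftReg μ)) : Set (L2 μ →L[ℂ] L2 μ)) := rfl

theorem tsum_ite_zero {E : Type*} [NormedAddCommGroup E] (f g : E) (b : E → E → ℂ) (hb : b 0 0 = 0) :
    ∑' n : ℕ, b (if n = 0 then f else 0) (if n = 0 then g else 0) = b f g := by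
  rw [tsum_eq_single 0]
  · simp
  · intro n hn; simp [hn, hb]

theorem summable_ite_zero {E : Type*} [NormedAddCommGroup E] (f g : E) :
    Summable fun n : ℕ => ‖if n = 0 then f else 0‖ * ‖if n = 0 then g else 0‖ :=
  summable_of_ne_finset_zero (s := {0}) fun n hn => by
    have : n ≠ 0 := by simpa using hn
    simp [this]

theorem represents_coefficient (f g : L2 μ) : Represents μ (fun x => inner ℂ g (leftReg μ x f))
    (fun n : ℕ => if n = 0 then f else 0) (fun n => if n = 0 then g else 0) :=
  ⟨summable_ite_zero f g, fun x =>
    (tsum_ite_zero f g (fun f g => (inner ℂ g (leftReg μ x f) : ℂ)) (by simp)).symm⟩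

theorem norm_leftReg_le (x : G) : ‖leftReg μ x‖ ≤ 1 :=
  ContinuousLinearMap.opNorm_le_bound _ zero_le_one fun f => by rw [norm_leftReg_apply, one_mul]

section Transposed

variable [TopologicalSpace G] {φ : G → ℂ} (hφ : φ ∈ multipliers μ)
  {Φ : groupVN μ →ₗ[ℂ] groupVN μ} (hΦ : IsTransposedMul μ φ Φ)

include hφ hΦ

/-- The transposed of a multiplication operator is normal. -/
theorem IsTransposedMul.exists_sum (f g : L2 μ) : ∃ f' g' : ℕ → L2 μ,
    Represents μ (fun x => φ x * inner ℂ g (leftReg μ x f)) f' g' ∧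
      ∀ T : groupVN μ, (inner ℂ g ((Φ T : L2 μ →L[ℂ] L2 μ) f) : ℂ) =
        ∑' n, inner ℂ (g' n) ((T : L2 μ →L[ℂ] L2 μ) (f' n)) := by
  have h1 := represents_coefficient f g
  obtain ⟨f', g', h2⟩ := hφ.2 _ ⟨_, _, h1⟩
  refine ⟨f', g', h2, fun T => ?_⟩
  rw [← hΦ T _ _ _ _ _ h1 h2]
  exact (tsum_ite_zero f g (fun f g => (inner ℂ g ((Φ T : L2 μ →L[ℂ] L2 μ) f) : ℂ)) (by simp)).symm

/-- The transposed map multiplies λ(x) by φ(x); pairing Φ(λ(x)) f with λ(x) f isolates φ(x)‖f‖². -/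
theorem IsTransposedMul.norm_le {C : ℝ} (hC : 0 ≤ C) (hcb : CBBound Φ C) {f : L2 μ} (hf : f ≠ 0) (x : G) :
    ‖φ x‖ ≤ C := by
  obtain ⟨f', g', h1, h2⟩ := hΦ.exists_sum hφ f (leftReg μ x f)
  have h3 := h2 (leftRegVN μ x)
  rw [coe_leftRegVN, ← h1.2 x] at h3
  have h4 := norm_inner_apply_le (Φ (leftRegVN μ x) : L2 μ →L[ℂ] L2 μ) f (leftReg μ x f)
  rw [h3, norm_mul, inner_self_eq_norm_sq_to_K, norm_leftReg_apply] at h4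
  have h5 : ‖(Φ (leftRegVN μ x) : L2 μ →L[ℂ] L2 μ)‖ ≤ C :=
    (hcb.norm_apply_le hC _).trans (mul_le_of_le_one_right hC (norm_leftReg_le x))
  have h6 : ‖φ x‖ * (‖f‖ * ‖f‖) ≤ C * (‖f‖ * ‖f‖) := by
    have : ‖φ x‖ * (‖f‖ * ‖f‖) ≤ ‖(Φ (leftRegVN μ x) : L2 μ →L[ℂ] L2 μ)‖ * (‖f‖ * ‖f‖) := by
      simpa [sq] using h4
    exact this.trans (by gcongr)
  have hpos : 0 < ‖f‖ * ‖f‖ := by have := norm_pos_iff.2 hf; positivity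
  exact le_of_mul_le_mul_right h6 hpos

end Transposed

end Coefficients

/-! ### Comparing sesquilinear maps with operators -/

section Forms

variable {ι K H E : Type*} [NormedAddCommGroup K] [InnerProductSpace ℂ K]
  [NormedAddCommGroup H] [InnerProductSpace ℂ H] [NormedAddCommGroup E] [NormedSpace ℂ E]

/-- A sesquilinear map with values in a space of functionals that agrees at a point with the form of
an operator on a dense set of vectors agrees with it everywhere. -/
theorem SpansDense.apply_eq_inner {V : ι → K →L[ℂ] H} (hV : SpansDense V)
    (Λ : H →L⋆[ℂ] H →L[ℂ] (E →L[ℂ] ℂ)) (T : E) (A : H →L[ℂ] H)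
    (h : ∀ i j f g, Λ (V i g) (V j f) T = inner ℂ (V i g) (A (V j f))) (v u : H) :
    Λ v u T = inner ℂ v (A u) := by
  let Λ' : H →L⋆[ℂ] H →L[ℂ] ℂ :=
    (ContinuousLinearMap.compL ℂ H (E →L[ℂ] ℂ) ℂ (ContinuousLinearMap.apply ℂ ℂ T)).comp Λ -
      ((ContinuousLinearMap.compL ℂ H H ℂ).flip A).comp (innerSL ℂ)
  have hΛ' : ∀ v u, Λ' v u = Λ v u T - inner ℂ v (A u) := fun v u => rfl
  have h0 : Λ' v u ∈ (⊥ : Submodule ℂ ℂ) := by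
    refine hV.mem_of_forall Λ' ⊥ (by simp) (fun i j f g => ?_) v u
    rw [Submodule.mem_bot, hΛ', h, sub_self]
  rw [Submodule.mem_bot, hΛ'] at h0
  exact sub_eq_zero.1 h0

end Forms

/-! ### The embedding of M(G) in B(L²(G ⧸ Γ)) ⊗ M(Γ) and the amplified multiplier -/

section Lattice

variable {G : Type*} [Group G] [MeasurableSpace G] [MeasurableMul₂ G] [MeasurableInv G]
  {Γ : Subgroup G} [Countable Γ] [MeasurableSingletonClass Γ] {s : BorelSection Γ} {μ : Measure G}
  [μ.IsMulLeftInvariant] {ν : Measure (G ⧸ Γ)}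

namespace IsQuotientMeasure

theorem measurable_cocycle (s : BorelSection Γ) (x : G) :
    Measurable fun q => (s.fib (x⁻¹ * s.toFun q))⁻¹ :=
  (s.measurable_fib.comp (s.measurable.const_mul x⁻¹)).inv

theorem ae_smul (h : IsQuotientMeasure s μ ν) {P : G ⧸ Γ → Prop} (hP : ∀ᵐ q ∂ν, P q) (x : G) :
    ∀ᵐ q ∂ν, P (x • q) := by
  have := h.invariant
  have := measurableConstSMul_quotient Γ
  exact (measurePreserving_smul x ν).quasiMeasurePreserving.ae hP

theorem integrable_inner_smul (h : IsQuotientMeasure s μ ν) (e e' : L2 ν) (x : G) :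
    Integrable (fun q => (inner ℂ (e' q) (e (x⁻¹ • q)) : ℂ)) ν := by
  have := h.invariant
  have := measurableConstSMul_quotient Γ
  have h1 := measurePreserving_smul x⁻¹ ν
  refine (L2.integrable_inner (𝕜 := ℂ) e' (Lp.compMeasurePreserving _ h1 e)).congr ?_
  filter_upwards [Lp.coeFn_compMeasurePreserving e h1] with q hq
  rw [hq]; rfl

theorem tsum_inner_leftReg_lift (h : IsQuotientMeasure s μ ν) (x : G) (e e' : L2 ν)
    {f g : ℕ → L2 (Measure.count : Measure Γ)} {θ : Γ → ℂ} (hθ : Represents Measure.count θ f g) :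
    ∑' n, (inner ℂ (h.lift e' (g n)) (leftReg μ x (h.lift e (f n))) : ℂ) =
      ∫ q, inner ℂ (e' q) (e (x⁻¹ • q)) * θ (s.fib (x⁻¹ * s.toFun q))⁻¹ ∂ν := by
  have hk := h.integrable_inner_smul e e' x
  let c : G ⧸ Γ → Γ := fun q => (s.fib (x⁻¹ * s.toFun q))⁻¹
  have hc : Measurable c := measurable_cocycle s x
  have hbd : ∀ n γ, ‖(inner ℂ (g n) (leftReg Measure.count γ (f n)) : ℂ)‖ ≤ ‖f n‖ * ‖g n‖ := fun n γ =>
    (norm_inner_apply_le _ _ _).trans (mul_le_of_le_one_left (by positivity) (norm_leftReg_le γ))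
  have hm : ∀ n, AEStronglyMeasurable
      (fun q => (inner ℂ (g n) (leftReg Measure.count (c q) (f n)) : ℂ)) ν := fun n =>
    ((measurable_of_countable fun γ : Γ =>
      (inner ℂ (g n) (leftReg Measure.count γ (f n)) : ℂ)).comp hc).aestronglyMeasurable
  have hint : ∀ n, Integrable (fun q => inner ℂ (e' q) (e (x⁻¹ • q)) *
      inner ℂ (g n) (leftReg Measure.count (c q) (f n))) ν := fun n =>
    hk.mul_bdd (hm n) (Eventually.of_forall fun q => hbd n (c q))
  have hsum : Summable fun n => ∫ q, ‖(inner ℂ (e' q) (e (x⁻¹ • q)) *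
      inner ℂ (g n) (leftReg Measure.count (c q) (f n)) : ℂ)‖ ∂ν := by
    refine Summable.of_nonneg_of_le (fun n => integral_nonneg fun q => norm_nonneg _) (fun n => ?_)
      (hθ.1.mul_left (∫ q, ‖(inner ℂ (e' q) (e (x⁻¹ • q)) : ℂ)‖ ∂ν))
    rw [← integral_mul_const]
    refine integral_mono (hint n).norm (hk.norm.mul_const _) fun q => ?_
    simp only [norm_mul]
    gcongr
    exact hbd n (c q)
  simp only [h.inner_leftReg_lift]
  refine (integral_tsum_of_summable_integral_norm hint hsum).trans ?_
  refine integral_congr_ae (Eventually.of_forall fun q => ?_)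
  simp only [tsum_mul_left]
  rw [← hθ.2]

/-- The constant function `1` in `L²(G ⧸ Γ)`. -/
def oneL2 (h : IsQuotientMeasure s μ ν) : L2 ν :=
  haveI := h.prob
  indicatorConstLp 2 MeasurableSet.univ (measure_ne_top ν _) 1

theorem coeFn_oneL2 (h : IsQuotientMeasure s μ ν) : h.oneL2 =ᵐ[ν] fun _ => 1 := by
  have := h.prob
  filter_upwards [indicatorConstLp_coeFn (p := 2) (hs := MeasurableSet.univ)
    (hμs := measure_ne_top ν Set.univ) (c := (1 : ℂ))] with q hq
  exact hq.trans (by simp)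

theorem norm_oneL2 (h : IsQuotientMeasure s μ ν) : ‖h.oneL2‖ = 1 := by
  have := h.prob
  rw [oneL2, norm_indicatorConstLp (by simp) (by simp)]
  simp

/-- Commutation with an `R` in the commutant of λ(Γ) equates two normal functionals of `T`, so it
suffices to take T = λ(x). There the entry is an integral of scalar multiples of the operators
λ_Γ(c(x,q)), all of which commute with `R`. -/
theorem entry_mem (h : IsQuotientMeasure s μ ν) (e e' : L2 ν) {T : L2 μ →L[ℂ] L2 μ}
    (hT : T ∈ groupVN μ) :
    ContinuousLinearMap.adjoint (h.lift e') ∘L T ∘L h.lift e ∈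
      groupVN (Measure.count : Measure Γ) := by
  have key : ∀ R ∈ StarSubalgebra.centralizer ℂ (Set.range (leftReg (Measure.count : Measure Γ))),
      R * (ContinuousLinearMap.adjoint (h.lift e') ∘L T ∘L h.lift e) =
        (ContinuousLinearMap.adjoint (h.lift e') ∘L T ∘L h.lift e) * R := by
    intro R hR
    ext1 f
    refine ext_inner_left ℂ fun g => ?_
    simp only [mul_apply_eq_comp, ContinuousLinearMap.comp_apply]
    rw [← ContinuousLinearMap.adjoint_inner_left, ContinuousLinearMap.adjoint_inner_right,
      ContinuousLinearMap.adjoint_inner_right]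
    have := eq_of_mem_normalFunctionals μ
      (vectorForm_mem_normalFunctionals (groupVN μ) (h.lift e f) (h.lift e' (ContinuousLinearMap.adjoint R g)))
      (vectorForm_mem_normalFunctionals (groupVN μ) (h.lift e (R f)) (h.lift e' g)) (fun x => by
        simp only [ContinuousLinearMap.comp_apply, incl_apply, vectorForm_apply, coe_leftRegVN]
        rw [h.inner_leftReg_lift, h.inner_leftReg_lift]
        congr 1
        funext q
        rw [ContinuousLinearMap.adjoint_inner_left]
        have h1 := ((StarSubalgebra.mem_centralizer_iff ℂ).1 hR _
          ⟨(s.fib (x⁻¹ * s.toFun q))⁻¹, rfl⟩).1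
        have h2 := congrArg (fun B : L2 (Measure.count : Measure Γ) →L[ℂ] L2 (Measure.count : Measure Γ) => B f) h1
        simp only [mul_apply_eq_comp] at h2
        rw [h2])
    exact congrArg (fun Λ : groupVN μ →L[ℂ] ℂ => Λ ⟨T, hT⟩) this
  refine (StarSubalgebra.mem_centralizer_iff ℂ).2 fun R hR => ⟨key R hR, key _ (star_mem hR)⟩

theorem isOrthIsometries_lift (h : IsQuotientMeasure s μ ν) {ι : Type*} (b : HilbertBasis ι ℂ (L2 ν)) :
    IsOrthIsometries fun i => h.lift (b i) := by
  refine ⟨fun i f g => ?_, fun i j f g hij => ?_⟩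
  · rw [h.inner_lift, inner_self_eq_norm_sq_to_K, b.orthonormal.1]; simp
  · rw [h.inner_lift, b.orthonormal.2 hij, zero_mul]

theorem spansDense_lift (h : IsQuotientMeasure s μ ν) {ι : Type*} (b : HilbertBasis ι ℂ (L2 ν)) :
    SpansDense fun i => h.lift (b i) := by
  intro W hW hb
  have hc : CompleteSpace W := hW.completeSpace_coe
  rw [← Submodule.orthogonal_eq_bot_iff, Submodule.eq_bot_iff]
  intro u hu
  refine h.eq_zero_of_inner_lift_eq_zero fun e f => ?_
  have hmem : h.lift e f ∈ W := by
    have h1 : (⊤ : Submodule ℂ (L2 ν)) ≤ W.comap (h.lift.flip f).toLinearMap := by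
      rw [← b.dense_span]
      refine Submodule.topologicalClosure_minimal _ (Submodule.span_le.2 ?_)
        (hW.preimage (h.lift.flip f).continuous)
      rintro _ ⟨i, rfl⟩
      exact hb i f
    exact h1 (Submodule.mem_top (x := e))
  exact (Submodule.mem_orthogonal _ _).1 hu _ hmem

/-- The weight on `G ⧸ Γ` by which the amplification of `m_φ^*` multiplies `λ(x)`. -/
def weight (s : BorelSection Γ) (φ : Γ → ℂ) (x : G) (q : G ⧸ Γ) : ℂ :=
  φ (s.fib (x⁻¹ * s.toFun q))⁻¹

theorem measurable_weight (s : BorelSection Γ) (φ : Γ → ℂ) (x : G) : Measurable (weight s φ x) :=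
  (measurable_of_countable φ).comp (measurable_cocycle s x)

set_option maxHeartbeats 2000000 in
/-- The amplification of `m_φ^*` from `M(Γ)` to `B(L²(G ⧸ Γ)) ⊗ M(Γ)`, restricted to `M(G)`. -/
theorem exists_amplified (h : IsQuotientMeasure s μ ν) [TopologicalSpace Γ] {φ : Γ → ℂ}
    (hφ : φ ∈ multipliers (Measure.count : Measure Γ))
    {Φ : groupVN (Measure.count : Measure Γ) →ₗ[ℂ] groupVN (Measure.count : Measure Γ)} {C : ℝ}
    (hC : 0 ≤ C) (hΦ : IsTransposedMul Measure.count φ Φ) (hcb : CBBound Φ C)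
    (hφC : ∀ γ, ‖φ γ‖ ≤ C) :
    ∃ Λ : L2 μ →L⋆[ℂ] L2 μ →L[ℂ] (groupVN μ →L[ℂ] ℂ),
      (∀ v u, Λ v u ∈ normalFunctionals (groupVN μ)) ∧
      (∀ v u x, Λ v u (leftRegVN μ x) =
        ∫ y, weight s φ x (QuotientGroup.mk y) * inner ℂ (v y) (leftReg μ x u y) ∂μ) ∧
      ∀ (n : ℕ) (T : Fin n → Fin n → groupVN μ) (c : ℝ), 0 ≤ c →
        FormBound (fun k l => (T k l : L2 μ →L[ℂ] L2 μ)) c → ∀ u v : Fin n → L2 μ,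
          ‖∑ k, ∑ l, Λ (v k) (u l) (T k l)‖ ≤ C * c * (√(∑ k, ‖u k‖ ^ 2) * √(∑ k, ‖v k‖ ^ 2)) := by
  obtain ⟨ι, b, -⟩ := exists_hilbertBasis ℂ (L2 ν)
  let V : ι → L2 (Measure.count : Measure Γ) →L[ℂ] L2 μ := fun i => h.lift (b i)
  have hVM : ∀ i j, ∀ T ∈ groupVN μ, ContinuousLinearMap.adjoint (V i) ∘L T ∘L V j ∈
      groupVN (Measure.count : Measure Γ) := fun i j T hT => h.entry_mem (b j) (b i) hT
  obtain ⟨Λ, hΛ, hΛn⟩ := exists_amplification (V := V) hVM (h.isOrthIsometries_lift b) hC hcb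
  have hdense : SpansDense V := h.spansDense_lift b
  have hgen : ∀ i j f g, ∃ f' g' : ℕ → L2 (Measure.count : Measure Γ),
      Represents Measure.count (fun γ => φ γ * inner ℂ g (leftReg Measure.count γ f)) f' g' ∧
      ∀ T, Λ (V i g) (V j f) T = ∑' n, inner ℂ (V i (g' n)) ((T : L2 μ →L[ℂ] L2 μ) (V j (f' n))) := by
    intro i j f g
    obtain ⟨f', g', h1, h2⟩ := hΦ.exists_sum hφ f g
    refine ⟨f', g', h1, fun T => ?_⟩
    rw [hΛ, h2]
    congr 1
    funext n
    rw [coe_entry, ContinuousLinearMap.comp_apply, ContinuousLinearMap.adjoint_inner_right]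
    rfl
  refine ⟨Λ, ?_, ?_, hΛn⟩
  -- Normality is visible only for vectors in the ranges of the `V i`; closedness of the normal
  -- functionals carries it to all vectors.
  · refine hdense.mem_of_forall Λ _ (isClosed_normalFunctionals (groupVN_eq μ)) fun i j f g => ?_
    obtain ⟨f', g', h1, h2⟩ := hgen i j f g
    refine mem_normalFunctionals_of_sum (groupVN_eq μ) ?_ _ h2
    refine h1.1.congr fun n => ?_
    simp only [V]
    rw [h.norm_lift, h.norm_lift, b.orthonormal.1, b.orthonormal.1, one_mul, one_mul]
  · intro v u x
    have hw := measurable_weight s φ x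
    have hwC : ∀ q, ‖weight s φ x q‖ ≤ C := fun q => hφC _
    have hw' : Measurable fun y : G => weight s φ x (QuotientGroup.mk y) :=
      hw.comp QuotientGroup.measurable_coe
    -- The expected image of λ(x). On tensors the multiplier replaces the coefficient at c(x,q) by
    -- φ(c(x,q)) times it, which is multiplication by the weight.
    let A : L2 μ →L[ℂ] L2 μ := mulOp hw' (fun y => hwC (QuotientGroup.mk y)) ∘L leftReg μ x
    rw [hdense.apply_eq_inner Λ (leftRegVN μ x) A (fun i j f g => ?_) v u]
    · simp only [A, ContinuousLinearMap.comp_apply, inner_mulOp]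
    · obtain ⟨f', g', h1, h2⟩ := hgen i j f g
      rw [h2]
      simp only [A, ContinuousLinearMap.comp_apply, inner_mulOp, coe_leftRegVN]
      refine (h.tsum_inner_leftReg_lift x _ _ h1).trans
        (Eq.trans ?_ (h.integral_mul_inner_leftReg_lift hw hwC x _ _ _ _).symm)
      congr 1
      funext q
      simp only [weight]
      ring

end IsQuotientMeasure

end Lattice

/-! ### From sesquilinear maps with values in functionals to linear maps on M -/

section SesquilinearForms

variable {H : Type*} [NormedAddCommGroup H] [InnerProductSpace ℂ H] [CompleteSpace H]
  {M : StarSubalgebra ℂ (H →L[ℂ] H)} {S : Set (H →L[ℂ] H)}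

/-- A bounded sesquilinear map with values in the functionals on a commutant `M` is given by a linear map
`M → M`, if it intertwines the operators that generate the commutant of `M`. -/
theorem exists_linearMap_of_form (hM : M = StarSubalgebra.centralizer ℂ S)
    (Λ : H → H → (M →L[ℂ] ℂ)) (c : ℝ)
    (hadd : ∀ v u u', Λ v (u + u') = Λ v u + Λ v u') (hsmul : ∀ (a : ℂ) v u, Λ v (a • u) = a • Λ v u)
    (hadd' : ∀ v v' u, Λ (v + v') u = Λ v u + Λ v' u)
    (hsmul' : ∀ (a : ℂ) v u, Λ (a • v) u = starRingEnd ℂ a • Λ v u)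
    (hb : ∀ v u, ‖Λ v u‖ ≤ c * ‖v‖ * ‖u‖)
    (hS : ∀ R ∈ S, ∀ v u, Λ (ContinuousLinearMap.adjoint R v) u = Λ v (R u))
    (hS' : ∀ R ∈ S, ∀ v u, Λ (R v) u = Λ v (ContinuousLinearMap.adjoint R u)) :
    ∃ Φ : M →ₗ[ℂ] M, ∀ T v u, inner ℂ v ((Φ T : H →L[ℂ] H) u) = Λ v u T := by
  have hop : ∀ T : M, ∃ A : H →L[ℂ] H, ∀ u v, inner ℂ v (A u) = Λ v u T := fun T =>
    exists_operator_of_form (fun u v => Λ v u T) (c * ‖T‖)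
      (fun u u' v => by rw [hadd]; rfl) (fun a u v => by rw [hsmul]; rfl)
      (fun u v v' => by rw [hadd']; rfl) (fun a u v => by rw [hsmul']; rfl)
      (fun u v => ((Λ v u).le_of_opNorm_le (hb v u) T).trans (le_of_eq (by ring)))
  choose A hA using hop
  have hAmem : ∀ T, A T ∈ M := by
    intro T
    rw [hM, StarSubalgebra.mem_centralizer_iff]
    refine fun R hR => ⟨?_, ?_⟩
    · ext1 u
      refine ext_inner_left ℂ fun v => ?_
      rw [mul_apply_eq_comp, mul_apply_eq_comp, ← ContinuousLinearMap.adjoint_inner_left, hA, hA, hS R hR]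
    · ext1 u
      refine ext_inner_left ℂ fun v => ?_
      rw [mul_apply_eq_comp, mul_apply_eq_comp, ContinuousLinearMap.star_eq_adjoint,
        ContinuousLinearMap.adjoint_inner_right, hA, hA, hS' R hR]
  exact ⟨{ toFun := fun T => ⟨A T, hAmem T⟩
           map_add' := fun T T' => by
             refine Subtype.ext (ContinuousLinearMap.ext fun u => ext_inner_left ℂ fun v => ?_)
             change inner ℂ v (A (T + T') u) = inner ℂ v (A T u + A T' u)
             rw [inner_add_right, hA, hA, hA, map_add]
           map_smul' := fun a T => by
             refine Subtype.ext (ContinuousLinearMap.ext fun u => ext_inner_left ℂ fun v => ?_)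
             change inner ℂ v (A (a • T) u) = inner ℂ v (a • A T u)
             rw [inner_smul_right, hA, hA, map_smul, smul_eq_mul] }, fun T v u => hA T u v⟩

theorem exists_tsum_mem_normalFunctionals (hM : M = StarSubalgebra.centralizer ℂ S)
    {Λ : H → H → (M →L[ℂ] ℂ)} {c : ℝ} (hb : ∀ v u, ‖Λ v u‖ ≤ c * ‖v‖ * ‖u‖)
    (hN : ∀ v u, Λ v u ∈ normalFunctionals M) {f g : ℕ → H}
    (hfg : Summable fun n => ‖f n‖ * ‖g n‖) :
    ∃ f' g' : ℕ → H, Summable (fun n => ‖f' n‖ * ‖g' n‖) ∧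
      ∀ T : M, ∑' n, inner ℂ (g' n) ((T : H →L[ℂ] H) (f' n)) = ∑' n, Λ (g n) (f n) T := by
  have hs : Summable fun n => Λ (g n) (f n) :=
    Summable.of_norm_bounded (hfg.mul_left c) fun n => (hb _ _).trans (le_of_eq (by ring))
  have hmem : ∑' n, Λ (g n) (f n) ∈ normalFunctionals M :=
    (isClosed_normalFunctionals hM).mem_of_tendsto hs.hasSum
      (Eventually.of_forall fun t => Submodule.sum_mem _ fun n _ => hN _ _)
  obtain ⟨f', g', h3, h4⟩ := exists_of_mem_normalFunctionals _ hmem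
  refine ⟨f', g', h3, fun T => ?_⟩
  rw [← h4]
  exact (ContinuousLinearMap.apply ℂ ℂ T).map_tsum hs

end SesquilinearForms

/-! ### Continuity, averaging over Ω, and the multiplier φ̂ -/

section Continuity

variable {G : Type*} [Group G] [TopologicalSpace G] [IsTopologicalGroup G]
    [LocallyCompactSpace G] [T2Space G] [SecondCountableTopology G]
    [MeasurableSpace G] [BorelSpace G] {μ : Measure G} [μ.IsHaarMeasure]

theorem continuous_leftReg_apply (f : L2 μ) : Continuous fun x => leftReg μ x f := by
  let m : C(G × G, G) := ⟨fun p => p.1⁻¹ * p.2, by fun_prop⟩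
  exact Continuous.compMeasurePreservingLp (f := fun _ : G => f) (g := fun x => m.curry x)
    continuous_const m.curry.continuous (fun x => measurePreserving_mul_left μ x⁻¹) (by simp)

theorem continuous_of_mem_fourierAlgebra {ψ : G → ℂ} (hψ : ψ ∈ fourierAlgebra μ) : Continuous ψ := by
  obtain ⟨f, g, h1, h2⟩ := hψ
  rw [funext h2]
  refine continuous_tsum (fun n => continuous_const.inner (continuous_leftReg_apply (f n))) h1
    fun n x => ?_
  exact (norm_inner_apply_le _ _ _).trans (mul_le_of_le_one_left (by positivity) (norm_leftReg_le x))

/-- Near x₀, φ is a quotient of continuous functions: with v = λ(x₀)u the coefficient ⟨λ(x)u, v⟩ is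
‖u‖² ≠ 0 at x₀. -/
theorem continuous_of_forall_mul_mem {φ : G → ℂ} {u : L2 μ} (hu : u ≠ 0)
    (h : ∀ v : L2 μ, (fun x => φ x * inner ℂ v (leftReg μ x u)) ∈ fourierAlgebra μ) :
    Continuous φ := by
  refine continuous_iff_continuousAt.2 fun x₀ => ?_
  have hc : Continuous fun x => (inner ℂ (leftReg μ x₀ u) (leftReg μ x u) : ℂ) :=
    continuous_const.inner (continuous_leftReg_apply u)
  have h0 : (inner ℂ (leftReg μ x₀ u) (leftReg μ x₀ u) : ℂ) ≠ 0 := by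
    rw [inner_self_ne_zero, ← norm_ne_zero_iff, norm_leftReg_apply, norm_ne_zero_iff]
    exact hu
  have h1 := (continuous_of_mem_fourierAlgebra (h (leftReg μ x₀ u))).continuousAt (x := x₀)
  refine (h1.div hc.continuousAt h0).congr ?_
  filter_upwards [hc.continuousAt.eventually_ne h0] with x hx
  simp only [Pi.div_apply]
  rw [mul_div_assoc, div_self hx, mul_one]

variable {Γ : Subgroup G} [Countable Γ] {s : BorelSection Γ} {ν : Measure (G ⧸ Γ)}

namespace IsQuotientMeasure

/-- The operator `u ↦ u(· z⁻¹)` on `L²(G)`. -/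
def rightTranslate (h : IsQuotientMeasure s μ ν) (hμ : μ (Set.range s.toFun) = 1) (z : G) :
    L2 μ →ₗᵢ[ℂ] L2 μ :=
  Lp.compMeasurePreservingₗᵢ ℂ (fun y : G => y * z⁻¹) (h.measurePreserving_mul_right hμ z⁻¹)

variable (h : IsQuotientMeasure s μ ν) (hμ : μ (Set.range s.toFun) = 1)

theorem coeFn_rightTranslate (z : G) (u : L2 μ) :
    h.rightTranslate hμ z u =ᵐ[μ] fun y => u (y * z⁻¹) :=
  Lp.coeFn_compMeasurePreserving u (h.measurePreserving_mul_right hμ z⁻¹)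

theorem continuous_rightTranslate_apply (u : L2 μ) : Continuous fun z => h.rightTranslate hμ z u := by
  let m : C(G × G, G) := ⟨fun p => p.2 * p.1⁻¹, by fun_prop⟩
  exact Continuous.compMeasurePreservingLp (f := fun _ : G => u) (g := fun x => m.curry x)
    continuous_const m.curry.continuous (fun z => h.measurePreserving_mul_right hμ z⁻¹) (by simp)

theorem leftReg_rightTranslate (x z : G) (u : L2 μ) :
    leftReg μ x (h.rightTranslate hμ z u) = h.rightTranslate hμ z (leftReg μ x u) := by
  refine Lp.ext ?_
  have h1 := (measurePreserving_mul_left μ x⁻¹).quasiMeasurePreserving.ae (h.coeFn_rightTranslate hμ z u)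
  have h2 := (h.measurePreserving_mul_right hμ z⁻¹).quasiMeasurePreserving.ae (coeFn_leftReg μ x u)
  filter_upwards [h1, h2, coeFn_leftReg μ x (h.rightTranslate hμ z u),
    h.coeFn_rightTranslate hμ z (leftReg μ x u)] with y h1 h2 h3 h4
  rw [h3, h1, h4, h2, mul_assoc]

/-- Averaging a bounded function on `G ⧸ Γ` over the right translates of the lattice. -/
theorem integral_weight_rightTranslate {w : G ⧸ Γ → ℂ} {C : ℝ} (hw : Measurable w)
    (hC : ∀ q, ‖w q‖ ≤ C) (u v : L2 μ) :
    ∫ z in Set.range s.toFun, ∫ y, w (QuotientGroup.mk y) *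
      inner ℂ (h.rightTranslate hμ z v y) (h.rightTranslate hμ z u y) ∂μ ∂μ =
      (∫ q, w q ∂ν) * inner ℂ v u := by
  have hfin : IsFiniteMeasure (μ.restrict (Set.range s.toFun)) := ⟨by simp [hμ]⟩
  let F : G → ℂ := fun y => inner ℂ (v y) (u y)
  have hF : Integrable F μ := L2.integrable_inner v u
  have h1 : ∀ z, ∫ y, w (QuotientGroup.mk y) *
      inner ℂ (h.rightTranslate hμ z v y) (h.rightTranslate hμ z u y) ∂μ =
      ∫ y, w (QuotientGroup.mk (y * z)) * F y ∂μ := fun z => by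
    -- Unimodularity permits y ↦ yz, which moves the translation from the vectors to the weight.
    -- Integrating w(yzΓ) over z ∈ Ω then gives the ν-mean of `w` for every y.
    have h2 := (h.measurePreserving_mul_right hμ z).integral_comp (measurableEmbedding_mulRight z)
      (fun y => w (QuotientGroup.mk y) * F (y * z⁻¹))
    simp only [mul_inv_cancel_right] at h2
    rw [h2]
    refine integral_congr_ae ?_
    filter_upwards [h.coeFn_rightTranslate hμ z u, h.coeFn_rightTranslate hμ z v] with y hu hv
    rw [hu, hv]
  simp only [h1]
  have hint : Integrable (Function.uncurry fun z y => w (QuotientGroup.mk (y * z)) * F y)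
      ((μ.restrict (Set.range s.toFun)).prod μ) := by
    have hFs : Integrable (fun p : G × G => F p.2) ((μ.restrict (Set.range s.toFun)).prod μ) :=
      hF.comp_snd _
    have hm : Measurable fun p : G × G => w (QuotientGroup.mk (p.2 * p.1)) :=
      hw.comp (QuotientGroup.measurable_coe.comp (measurable_snd.mul measurable_fst))
    exact hFs.bdd_mul hm.aestronglyMeasurable (Eventually.of_forall fun p => hC _)
  rw [integral_integral_swap hint, L2.inner_def, ← integral_const_mul]
  congr 1
  funext y
  rw [integral_mul_const]
  congr 1
  rw [← h.integral_smul_eq hw y]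
  conv_rhs => rw [← h.measurePreserving_mk.map_eq]
  have := measurableConstSMul_quotient Γ
  exact (integral_map QuotientGroup.measurable_coe.aemeasurable
    (hw.comp (measurable_const_smul y)).aestronglyMeasurable).symm

/-- The average of a bounded sesquilinear map over the right translations by elements of `Ω`. -/
def average {E : Type*} [NormedAddCommGroup E] [NormedSpace ℂ E] (Λ : L2 μ →L⋆[ℂ] L2 μ →L[ℂ] E)
    (v u : L2 μ) : E :=
  ∫ z in Set.range s.toFun, Λ (h.rightTranslate hμ z v) (h.rightTranslate hμ z u) ∂μ

section Average

variable {E : Type*} [NormedAddCommGroup E] [NormedSpace ℂ E] (Λ : L2 μ →L⋆[ℂ] L2 μ →L[ℂ] E)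

include hμ in
theorem isProbabilityMeasure_restrict : IsProbabilityMeasure (μ.restrict (Set.range s.toFun)) :=
  ⟨by simp [hμ]⟩

theorem integrable_translates (v u : L2 μ) :
    Integrable (fun z => Λ (h.rightTranslate hμ z v) (h.rightTranslate hμ z u))
      (μ.restrict (Set.range s.toFun)) := by
  have := isProbabilityMeasure_restrict (s := s) hμ
  have hc : Continuous fun z => Λ (h.rightTranslate hμ z v) (h.rightTranslate hμ z u) :=
    (Λ.continuous.comp (h.continuous_rightTranslate_apply hμ v)).clm_apply
      (h.continuous_rightTranslate_apply hμ u)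
  refine Integrable.of_bound hc.aestronglyMeasurable (‖Λ‖ * ‖v‖ * ‖u‖) (Eventually.of_forall fun z => ?_)
  refine (Λ.le_opNorm₂ _ _).trans ?_
  rw [LinearIsometry.norm_map, LinearIsometry.norm_map]

theorem average_add_left (v v' u : L2 μ) :
    h.average hμ Λ (v + v') u = h.average hμ Λ v u + h.average hμ Λ v' u := by
  rw [average, average, average,
    ← integral_add (h.integrable_translates hμ Λ v u) (h.integrable_translates hμ Λ v' u)]
  simp

theorem average_add_right (v u u' : L2 μ) :
    h.average hμ Λ v (u + u') = h.average hμ Λ v u + h.average hμ Λ v u' := by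
  rw [average, average, average,
    ← integral_add (h.integrable_translates hμ Λ v u) (h.integrable_translates hμ Λ v u')]
  simp

theorem average_smul_left (c : ℂ) (v u : L2 μ) :
    h.average hμ Λ (c • v) u = starRingEnd ℂ c • h.average hμ Λ v u := by
  rw [average, average, ← integral_smul]
  simp

theorem average_smul_right (c : ℂ) (v u : L2 μ) :
    h.average hμ Λ v (c • u) = c • h.average hμ Λ v u := by
  rw [average, average, ← integral_smul]
  simp

theorem exists_norm_average_le : ∃ c, ∀ v u : L2 μ, ‖h.average hμ Λ v u‖ ≤ c * ‖v‖ * ‖u‖ := by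
  refine ⟨‖Λ‖, fun v u => ?_⟩
  have := isProbabilityMeasure_restrict (s := s) hμ
  refine (norm_integral_le_of_norm_le_const (C := ‖Λ‖ * ‖v‖ * ‖u‖) (Eventually.of_forall fun z => ?_)).trans ?_
  · refine (Λ.le_opNorm₂ _ _).trans ?_
    rw [LinearIsometry.norm_map, LinearIsometry.norm_map]
  · simp

/-- Since μ(Ω) = 1, the average is a mean over a probability measure and stays in a closed convex
set. It is applied to the normal functionals. -/
theorem average_mem [CompleteSpace E] {W : Submodule ℂ E} (hW : IsClosed (W : Set E)) (hΛ : ∀ v u, Λ v u ∈ W)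
    (v u : L2 μ) : h.average hμ Λ v u ∈ W := by
  have := isProbabilityMeasure_restrict (s := s) hμ
  exact (W.restrictScalars ℝ).convex.integral_mem hW (Eventually.of_forall fun z => hΛ _ _)
    (h.integrable_translates hμ Λ v u)

end Average

theorem average_apply {E : Type*} [NormedAddCommGroup E] [NormedSpace ℂ E]
    (Λ : L2 μ →L⋆[ℂ] L2 μ →L[ℂ] (E →L[ℂ] ℂ)) (v u : L2 μ) (T : E) :
    h.average hμ Λ v u T =
      ∫ z in Set.range s.toFun, Λ (h.rightTranslate hμ z v) (h.rightTranslate hμ z u) T ∂μ :=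
  ContinuousLinearMap.integral_apply (h.integrable_translates hμ Λ v u) T

theorem integrable_translates_apply {E : Type*} [NormedAddCommGroup E] [NormedSpace ℂ E]
    (Λ : L2 μ →L⋆[ℂ] L2 μ →L[ℂ] (E →L[ℂ] ℂ)) (v u : L2 μ) (T : E) :
    Integrable (fun z => Λ (h.rightTranslate hμ z v) (h.rightTranslate hμ z u) T)
      (μ.restrict (Set.range s.toFun)) :=
  (ContinuousLinearMap.apply ℂ ℂ T).integrable_comp (h.integrable_translates hμ Λ v u)

end IsQuotientMeasure

/-- A bounded sesquilinear map with values in the normal functionals on `M(G)`, whose values at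
`λ(x)` are multiples `φ(x)` of the coefficients of `λ`, comes from the transposed multiplication operator
of `φ`. -/
theorem exists_isTransposedMul_of_form {φ : G → ℂ} {u₀ : L2 μ} (hu₀ : u₀ ≠ 0)
    (Λ : L2 μ → L2 μ → (groupVN μ →L[ℂ] ℂ)) (c : ℝ)
    (hadd : ∀ v u u', Λ v (u + u') = Λ v u + Λ v u') (hsmul : ∀ (a : ℂ) v u, Λ v (a • u) = a • Λ v u)
    (hadd' : ∀ v v' u, Λ (v + v') u = Λ v u + Λ v' u)
    (hsmul' : ∀ (a : ℂ) v u, Λ (a • v) u = starRingEnd ℂ a • Λ v u)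
    (hb : ∀ v u, ‖Λ v u‖ ≤ c * ‖v‖ * ‖u‖)
    (hN : ∀ v u, Λ v u ∈ normalFunctionals (groupVN μ))
    (hφ : ∀ v u x, Λ v u (leftRegVN μ x) = φ x * inner ℂ v (leftReg μ x u)) :
    φ ∈ multipliers μ ∧ ∃ Φ : groupVN μ →ₗ[ℂ] groupVN μ, IsTransposedMul μ φ Φ ∧
      ∀ T v u, inner ℂ v ((Φ T : L2 μ →L[ℂ] L2 μ) u) = Λ v u T := by
  -- The intertwining relation equates normal functionals, so it need only be tested at λ(x), where
  -- it is commutation of `R` with λ(x). It forces the resulting map to take values in M(G).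
  have hcomm : ∀ R, (∀ x, leftReg μ x * R = R * leftReg μ x) → ∀ v u,
      Λ (ContinuousLinearMap.adjoint R v) u = Λ v (R u) := by
    intro R hR v u
    refine eq_of_mem_normalFunctionals μ (hN _ _) (hN _ _) fun x => ?_
    rw [hφ, hφ, ContinuousLinearMap.adjoint_inner_left]
    have h2 := congrArg (fun B : L2 μ →L[ℂ] L2 μ => B u) (hR x)
    simp only [mul_apply_eq_comp] at h2
    rw [h2]
  have hR : ∀ R ∈ StarSubalgebra.centralizer ℂ (Set.range (leftReg μ)), ∀ x,
      leftReg μ x * R = R * leftReg μ x := fun R hR x =>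
    ((StarSubalgebra.mem_centralizer_iff ℂ).1 hR _ ⟨x, rfl⟩).1
  obtain ⟨Φ, hΦ⟩ := exists_linearMap_of_form (groupVN_eq μ) Λ c hadd hsmul hadd' hsmul' hb
    (fun R hR' => hcomm R (hR R hR')) (fun R hR' v u => by
      have h1 := hcomm (ContinuousLinearMap.adjoint R) (hR _ (star_mem hR')) v u
      rwa [ContinuousLinearMap.adjoint_adjoint] at h1)
  have hmul : ∀ ψ ∈ fourierAlgebra μ, (fun x => φ x * ψ x) ∈ fourierAlgebra μ := by
    rintro ψ ⟨f, g, h1, h2⟩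
    obtain ⟨f', g', h3, h4⟩ := exists_tsum_mem_normalFunctionals (groupVN_eq μ) hb hN h1
    refine ⟨f', g', h3, fun x => ?_⟩
    change φ x * ψ x = _
    rw [← coe_leftRegVN, h4, h2, ← tsum_mul_left]
    exact tsum_congr fun n => (hφ _ _ _).symm
  refine ⟨⟨continuous_of_forall_mul_mem hu₀ fun v => hmul _ ⟨_, _, represents_coefficient u₀ v⟩, hmul⟩,
    Φ, ?_, hΦ⟩
  intro T ψ f g f' g' h1 h2
  obtain ⟨f₁, g₁, h3, h4⟩ := exists_tsum_mem_normalFunctionals (groupVN_eq μ) hb hN h1.1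
  refine (tsum_congr fun n => hΦ T (g n) (f n)).trans ((h4 T).symm.trans ?_)
  refine tsum_inner_eq_of_leftReg μ h3 h2.1 (fun x => ?_) T
  rw [← h2.2 x, ← coe_leftRegVN, h4]
  change _ = φ x * ψ x
  rw [h1.2, ← tsum_mul_left]
  exact tsum_congr fun n => hφ _ _ _

namespace IsQuotientMeasure

variable (h : IsQuotientMeasure s μ ν) (hμ : μ (Set.range s.toFun) = 1)

/-- The hat of an element of the Fourier algebra has a representation of the same size. -/
theorem represents_hat (h : IsQuotientMeasure s μ ν) {φ : Γ → ℂ}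
    {f g : ℕ → L2 (Measure.count : Measure Γ)} (hφ : Represents Measure.count φ f g) :
    Represents μ (hat μ Γ (Set.range s.toFun) φ) (fun n => h.lift h.oneL2 (f n))
      (fun n => h.lift h.oneL2 (g n)) := by
  refine ⟨?_, fun x => ?_⟩
  · simpa only [h.norm_lift, h.norm_oneL2, one_mul] using hφ.1
  · rw [h.tsum_inner_leftReg_lift x _ _ hφ, h.hat_eq]
    refine integral_congr_ae ?_
    filter_upwards [h.coeFn_oneL2, h.ae_smul h.coeFn_oneL2 x⁻¹] with q h1 h2
    rw [h1, h2]
    simp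

include h hμ in
-- The constant `C` is kept unchanged, so every cb bound for φ is one for φ̂; this yields the
-- inequality of norms as infima.
theorem hat_mem_multipliers {φ : Γ → ℂ} (hφ : φ ∈ multipliers (Measure.count : Measure Γ))
    {Φ : groupVN (Measure.count : Measure Γ) →ₗ[ℂ] groupVN (Measure.count : Measure Γ)} {C : ℝ}
    (hC : 0 ≤ C) (hΦ : IsTransposedMul Measure.count φ Φ) (hcb : CBBound Φ C) :
    hat μ Γ (Set.range s.toFun) φ ∈ multipliers μ ∧
      ∃ Ψ : groupVN μ →ₗ[ℂ] groupVN μ,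
        IsTransposedMul μ (hat μ Γ (Set.range s.toFun) φ) Ψ ∧ CBBound Ψ C := by
  let δ : L2 (Measure.count : Measure Γ) :=
    indicatorConstLp 2 (measurableSet_singleton (1 : Γ)) (by simp) 1
  have hδ : ‖δ‖ = 1 := by
    simp only [δ]
    rw [norm_indicatorConstLp (by simp) (by simp)]
    simp [Measure.real]
  have hδ0 : δ ≠ 0 := by rw [← norm_ne_zero_iff, hδ]; exact one_ne_zero
  have hu₀ : h.lift h.oneL2 δ ≠ 0 := by
    rw [← norm_ne_zero_iff, h.norm_lift, h.norm_oneL2, hδ, one_mul]; exact one_ne_zero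
  have hφC : ∀ γ, ‖φ γ‖ ≤ C := hΦ.norm_le hφ hC hcb hδ0
  obtain ⟨Λ, hΛN, hΛx, hΛn⟩ := h.exists_amplified (μ := μ) hφ hC hΦ hcb hφC
  have hprob := isProbabilityMeasure_restrict (s := s) hμ
  obtain ⟨c, hc⟩ := h.exists_norm_average_le (E := groupVN μ →L[ℂ] ℂ) hμ Λ
  obtain ⟨hmult, Ψ, hΨ, hΨΛ⟩ := exists_isTransposedMul_of_form (φ := hat μ Γ (Set.range s.toFun) φ)
    hu₀ (h.average (E := groupVN μ →L[ℂ] ℂ) hμ Λ) c (h.average_add_right (E := groupVN μ →L[ℂ] ℂ) hμ Λ) (h.average_smul_right (E := groupVN μ →L[ℂ] ℂ) hμ Λ)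
    (h.average_add_left (E := groupVN μ →L[ℂ] ℂ) hμ Λ) (h.average_smul_left (E := groupVN μ →L[ℂ] ℂ) hμ Λ) hc
    (h.average_mem (E := groupVN μ →L[ℂ] ℂ) hμ Λ (isClosed_normalFunctionals (groupVN_eq μ)) hΛN) (fun v u x => by
      rw [h.average_apply]
      simp only [hΛx, h.leftReg_rightTranslate]
      rw [h.integral_weight_rightTranslate hμ (measurable_weight s φ x) (fun q => hφC _), h.hat_eq]
      rfl)
  refine ⟨hmult, Ψ, hΨ, fun n T => FormBound.norm_opMatrix_le (by positivity) fun u v => ?_⟩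
  simp only [hΨΛ, h.average_apply]
  have hint := fun k l => h.integrable_translates_apply hμ Λ (v k) (u l) (T k l)
  have hsum : ∑ k, ∑ l, ∫ z in Set.range s.toFun,
        Λ (h.rightTranslate hμ z (v k)) (h.rightTranslate hμ z (u l)) (T k l) ∂μ =
      ∫ z in Set.range s.toFun, ∑ k, ∑ l,
        Λ (h.rightTranslate hμ z (v k)) (h.rightTranslate hμ z (u l)) (T k l) ∂μ := by
    rw [integral_finsetSum _ fun k _ => integrable_finsetSum _ fun l _ => hint k l]
    exact Finset.sum_congr rfl fun k _ => (integral_finsetSum _ fun l _ => hint k l).symm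
  rw [hsum]
  -- Right translations are isometries, so the matrix bound of Λ is uniform in z; integrating over
  -- Ω, of measure one, preserves it.
  refine (norm_integral_le_of_norm_le_const (C := C * ‖opMatrix fun k l => (T k l : L2 μ →L[ℂ] L2 μ)‖ *
    (√(∑ k, ‖u k‖ ^ 2) * √(∑ k, ‖v k‖ ^ 2))) (Eventually.of_forall fun z => ?_)).trans ?_
  · have := hΛn n T _ (norm_nonneg _) (formBound_opMatrix _)
      (fun k => h.rightTranslate hμ z (u k)) (fun k => h.rightTranslate hμ z (v k))
    simpa only [LinearIsometry.norm_map] using this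
  · simp

end IsQuotientMeasure

end Continuity

end

end FourierLattice

/-! ### The theorem -/

open FourierLattice in
theorem lemma2p1 {G : Type*} [Group G] [TopologicalSpace G] [IsTopologicalGroup G]
    [LocallyCompactSpace G] [T2Space G] [SecondCountableTopology G]
    [MeasurableSpace G] [BorelSpace G]
    (Γ : Subgroup G) (hΓ : IsLattice Γ)
    (Ω : Set G) (hΩ : IsBorelFundamentalDomain Γ Ω)
    (μ : Measure G) [μ.IsHaarMeasure] (hμ : μ Ω = 1) :
    (∀ φ : Γ → ℂ, φ ∈ fourierAlgebra (Measure.count : Measure Γ) →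
      hat μ Γ Ω φ ∈ fourierAlgebra μ ∧
        fourierNorm μ (hat μ Γ Ω φ) ≤ fourierNorm (Measure.count : Measure Γ) φ) ∧
    (∀ φ : Γ → ℂ, φ ∈ cbMultipliers (Measure.count : Measure Γ) →
      hat μ Γ Ω φ ∈ cbMultipliers μ ∧
        cbMultiplierNorm μ (hat μ Γ Ω φ) ≤
          cbMultiplierNorm (Measure.count : Measure Γ) φ) := by
  obtain ⟨σ, hσ, hσ', rfl⟩ := hΩ
  have := hΓ.discrete
  have : Countable Γ := countable_of_Lindelof_of_discrete
  let s : BorelSection Γ := ⟨σ, hσ, hσ'⟩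
  obtain ⟨ν, h⟩ := exists_isQuotientMeasure hΓ s μ hμ
  refine ⟨fun φ hφ => ?_, fun φ hφ => ?_⟩
  · obtain ⟨f, g, hfg⟩ := hφ
    refine ⟨⟨_, _, h.represents_hat hfg⟩, ?_⟩
    -- Every representation of φ gives one of φ̂ of the same size, so the infimum for φ̂ runs over a
    -- larger set.
    refine csInf_le_csInf ⟨0, ?_⟩ ⟨_, f, g, hfg, rfl⟩ ?_
    · rintro _ ⟨f, g, -, rfl⟩
      exact tsum_nonneg fun n => by positivity
    · rintro _ ⟨f, g, hfg, rfl⟩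
      refine ⟨_, _, h.represents_hat hfg, ?_⟩
      simp only [h.norm_lift, h.norm_oneL2, one_mul]
  · obtain ⟨hm, Φ, C, hΦ, hC, hcb⟩ := hφ
    obtain ⟨hm', Ψ, hΨ, hcb'⟩ := h.hat_mem_multipliers hμ hm hC hΦ hcb
    refine ⟨⟨hm', Ψ, C, hΨ, hC, hcb'⟩, ?_⟩
    refine csInf_le_csInf ⟨0, fun _ hx => hx.1⟩ ⟨C, hC, Φ, hΦ, hcb⟩ ?_
    rintro C' ⟨hC', Φ', hΦ', hcb'⟩
    exact ⟨hC', (h.hat_mem_multipliers hμ hm hC' hΦ' hcb').2⟩
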